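/- Setting. Let $C\ge 2$ be the number of colleges and let $\underline u<\overline u$ with $\overline u>0$. Types are $\theta=(\boldsymbol u,\boldsymbol s)\in\Theta=[\underline u,\overline u]^C\times[0,1]^C$ (utilities and scores). Let $\eta$ be a probability measure on $\Theta$ that is absolutely continuous with respect to Lebesgue measure and has full support, in the sense that every open subset of $\Theta$ meeting $[\max\{\underline u,0\},\overline u]^C\times[0,1]^C$ has positive $\eta$-measure. Let $\boldsymbol S=(S_c)_c$ with $0<S_c<1$. Let $\mathcal R$ be the finite set of rank-order lists (duplicate-free, possibly empty lists of colleges), and let $\rho(\theta)\in\mathcal R$ be the truthful list: the colleges with $u_c>0$ in decreasing order of $u_c$, ties broken by index. Strategies. A strategy profile is a sequence $\boldsymbol\sigma=(\sigma_1,\sigma_2,\dots)$ of measurable maps $\sigma_i:\Theta\to\Delta(\mathcal R)$. For $\gamma>0$ it is $\gamma$-regular if $\sigma_i(\theta)(\{\rho(\theta)\})\ge\gamma$ for all $i$ and all $\theta\in\Theta$, and it is symmetric if all $\sigma_i$ are equal. Economies. In the random economy $F^k$ there are $k$ applicants with types $\theta_1,\dots,\theta_k$ i.i.d. with law $\eta$;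 applicant $j$ submits a list $R_j$ drawn from $\sigma_j(\theta_j)$, independently across applicants; college $c$ has $[kS_c]$ seats, the integer nearest to $kS_c$ (rounded down in case of a tie). The economies $F^1,F^2,\dots$ live on a common probability space; their dependence on one another is arbitrary. For $i\in\mathbb N\cup\{0\}$, consider the lists obtained when $R_i$ is replaced by $\rho(\theta_i)$ and all other lists are kept (no change if $i=0$ or $i>k$). Run applicant-proposing deferred acceptance with these lists, the colleges ranking applicants by scores, and let $\boldsymbol P^k_{(i)}(\boldsymbol\sigma)\in[0,1]^C$ be the vector of cutoffs of its outcome: the cutoff of $c$ is the lowest score at $c$ among the applicants matched with $c$ if the capacity of $c$ is reached, and $0$ otherwise (and $1$ if $c$ has no seats). For $\boldsymbol p\in[0,1]^C$ let $D^k_{(i),c}(\boldsymbol p)$ be the fraction of the $k$ applicants for whom $c$ is the highest college on their list among the colleges $c'$ with $s_{c'}\ge p_{c'}$, and let $\overline{\boldsymbol D}{}^k_{(i)}(\boldsymbol p)=\mathbb E[\boldsymbol D^k_{(i)}(\boldsymbol p)]$. Let $\lVert\cdot\rVert$ be the sup norm on $\mathbb R^C$. Claim. Let $\boldsymbol\sigma$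 be any $\gamma$-regular strategy profile, possibly asymmetric. Then there are a subsequence $(k_\ell)_\ell$, a function $\overline{\boldsymbol D}$ on $[0,1]^C$ and a deterministic vector $\overline{\boldsymbol p}(\boldsymbol\sigma)\in[0,1]^C$, none of which depends on the probability space or on the dependence between the economies, such that $$\sup_{i\in\mathbb N\cup\{0\},\ \boldsymbol p\in[0,1]^C}\bigl\lVert\overline{\boldsymbol D}{}^{k_\ell}_{(i)}(\boldsymbol p)-\overline{\boldsymbol D}(\boldsymbol p)\bigr\rVert\to0,$$ $\overline{\boldsymbol p}(\boldsymbol\sigma)$ is the vector of deferred acceptance cutoffs of the demand system $\overline{\boldsymbol D}$ with capacities $\boldsymbol S$, i.e. $\overline{\boldsymbol p}(\boldsymbol\sigma)=\lim_m\overline{\boldsymbol p}{}^m$ with $\overline{\boldsymbol p}{}^0=\boldsymbol 0$ and $\overline p{}^{m}_c=\sup\{p\in[0,1]:\overline D_c(p,\overline{\boldsymbol p}{}^{m-1}_{-c})=S_c\}$ ($0$ if this set is empty), and $$\sup_{i\in\mathbb N\cup\{0\}}\bigl\lVert\boldsymbol P^{k_\ell}_{(i)}(\boldsymbol\sigma)-\overline{\boldsymbol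 p}(\boldsymbol\sigma)\bigr\rVert\longrightarrow0\quad\text{almost surely as }\ell\to\infty.$$ If $\boldsymbol\sigma$ is symmetric, then the same holds along the whole sequence of economies, i.e. with $k_\ell=\ell$. -/

import Mathlib

open MeasureTheory ProbabilityTheory Filter Topology

universe u

noncomputable section

/-- The type space `[a, b]^C × [0, 1]^C`: a vector of utilities and a vector of scores. -/
abbrev ApplicantType (C : ℕ) (a b : ℝ) : Type :=
  (Fin C → Set.Icc a b) × (Fin C → Set.Icc (0 : ℝ) 1)

namespace ApplicantType

variable {C : ℕ} {a b : ℝ}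

/-- The utility of college `c`. -/
def utility (t : ApplicantType C a b) (c : Fin C) : ℝ := t.1 c

/-- The score at college `c`. -/
def score (t : ApplicantType C a b) (c : Fin C) : ℝ := t.2 c

end ApplicantType

/-- Rank-order lists: duplicate-free lists of colleges of any length (possibly empty), most
preferred college first. -/
def ROL (C : ℕ) : Type := {l : List (Fin C) // l.Nodup}

instance (C : ℕ) : Fintype (ROL C) := inferInstanceAs (Fintype {l : List (Fin C) // l.Nodup})

instance (C : ℕ) : MeasurableSpace (ROL C) := ⊤

instance (C : ℕ) : DiscreteMeasurableSpace (ROL C) := ⟨fun _ => trivial⟩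

/-- The truthful rank-order list: the colleges with positive utility, by decreasing utility
(colleges with equal utilities are ordered by their index). -/
def truthfulROL {C : ℕ} {a b : ℝ} (t : ApplicantType C a b) : ROL C :=
  ⟨((List.finRange C).filter (fun c => 0 < t.utility c)).insertionSort
      (fun c d => t.utility d ≤ t.utility c),
    (List.perm_insertionSort _ _).nodup_iff.mpr ((List.nodup_finRange C).filter _)⟩

/-! ### Deferred acceptance in a finite economy

`k` applicants, with scores `s j c` and submitted lists `R j`; college `c` has `q c` seats. -/

section DeferredAcceptance

variable {k C : ℕ}

/-- At college `c`, applicant `j` is ranked above applicant `j'`: her score is higher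
(equal scores are ordered by index). -/
def RankedAbove (s : Fin k → Fin C → ℝ) (c : Fin C) (j j' : Fin k) : Prop :=
  s j' c < s j c ∨ (s j c = s j' c ∧ j < j')

/-- If `n j` is the number of rejections that each applicant `j` has received so far, then
`applicantPool R n c` is the set of applicants who are at college `c`, newly applying or held from
before. -/
def applicantPool (R : Fin k → ROL C) (n : Fin k → ℕ) (c : Fin C) : Finset (Fin k) :=
  Finset.univ.filter (fun j => (R j).1[n j]? = some c)

open Classical in
/-- Applicant `j` is rejected in the current round: at the college where she is, the seats can be
filled with applicants of the pool who are ranked above her. -/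
def IsRejected (s : Fin k → Fin C → ℝ) (R : Fin k → ROL C) (q : Fin C → ℕ) (n : Fin k → ℕ)
    (j : Fin k) : Prop :=
  ∃ c, j ∈ applicantPool R n c ∧
    q c ≤ ((applicantPool R n c).filter (fun j' => RankedAbove s c j' j)).card

open Classical in
/-- One round of applicant-proposing deferred acceptance, acting on the numbers of rejections. -/
def daRound (s : Fin k → Fin C → ℝ) (R : Fin k → ROL C) (q : Fin C → ℕ) (n : Fin k → ℕ) :
    Fin k → ℕ :=
  fun j => if IsRejected s R q n j then n j + 1 else n j

/-- The numbers of rejections when deferred acceptance ends. It ends within `k * C` rounds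
(`daRound_daFinal`), because every round but the last one issues a rejection. -/
def daFinal (s : Fin k → Fin C → ℝ) (R : Fin k → ROL C) (q : Fin C → ℕ) : Fin k → ℕ :=
  (daRound s R q)^[k * C] (fun _ => 0)

/-- The set of applicants matched with college `c` by deferred acceptance. -/
def daMatched (s : Fin k → Fin C → ℝ) (R : Fin k → ROL C) (q : Fin C → ℕ) (c : Fin C) :
    Finset (Fin k) :=
  applicantPool R (daFinal s R q) c

/-- The cutoffs of the deferred acceptance outcome: the lowest score among the matched applicants
if the capacity is reached, and `0` otherwise. (A college without seats gets the cutoff `1`.) -/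
def daCutoff (s : Fin k → Fin C → ℝ) (R : Fin k → ROL C) (q : Fin C → ℕ) (c : Fin C) : ℝ :=
  if (daMatched s R q c).card < q c then 0
  else if h : (daMatched s R q c).Nonempty then (daMatched s R q c).inf' h (fun j => s j c)
  else 1

theorem le_daRound (s : Fin k → Fin C → ℝ) (R : Fin k → ROL C) (q : Fin C → ℕ) (n : Fin k → ℕ)
    (j : Fin k) : n j ≤ daRound s R q n j := by
  unfold daRound; split_ifs <;> omega

theorem daRound_le (s : Fin k → Fin C → ℝ) (R : Fin k → ROL C) (q : Fin C → ℕ) (n : Fin k → ℕ)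
    (h : ∀ j, n j ≤ C) (j : Fin k) : daRound s R q n j ≤ C := by
  unfold daRound
  split_ifs with hr
  · obtain ⟨c, hc, -⟩ := hr
    have h1 : (R j).1[n j]? = some c := by simpa [applicantPool] using hc
    obtain ⟨h2, -⟩ := List.getElem?_eq_some_iff.mp h1
    have h3 : (R j).1.length ≤ C := by simpa using (R j).2.length_le_card
    omega
  · exact h j

/-- No rejection is issued any more after `k * C` rounds. -/
theorem daRound_daFinal (s : Fin k → Fin C → ℝ) (R : Fin k → ROL C) (q : Fin C → ℕ) :
    daRound s R q (daFinal s R q) = daFinal s R q := by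
  have hle : ∀ m j, ((daRound s R q)^[m] (fun _ => 0)) j ≤ C := by
    intro m
    induction m with
    | zero => intro j; simp
    | succ m ih => rw [Function.iterate_succ_apply']; exact daRound_le s R q _ ih
  have key : ∀ m, daRound s R q ((daRound s R q)^[m] (fun _ => 0))
        = (daRound s R q)^[m] (fun _ => 0) ∨
      m + 1 ≤ ∑ j, ((daRound s R q)^[m + 1] (fun _ => 0)) j := by
    intro m
    induction m with
    | zero =>
      by_cases hf : daRound s R q (fun _ => 0) = (fun _ => 0)
      · exact Or.inl hf
      · right
        obtain ⟨j, hj⟩ := Function.ne_iff.mp hf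
        have := Finset.single_le_sum (f := fun j => daRound s R q (fun _ => 0) j)
          (fun _ _ => Nat.zero_le _) (Finset.mem_univ j)
        simp only [Function.iterate_one, zero_add]
        omega
    | succ m ih =>
      rcases ih with ih | ih
      · left
        rw [Function.iterate_succ_apply', ih, ih]
      · by_cases hf : daRound s R q ((daRound s R q)^[m + 1] (fun _ => 0))
            = (daRound s R q)^[m + 1] (fun _ => 0)
        · exact Or.inl hf
        · right
          obtain ⟨j, hj⟩ := Function.ne_iff.mp hf
          have hlt : ∑ j, ((daRound s R q)^[m + 1] (fun _ => 0)) j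
              < ∑ j, ((daRound s R q)^[m + 1 + 1] (fun _ => 0)) j := by
            rw [Function.iterate_succ_apply' _ (m + 1)]
            exact Finset.sum_lt_sum (fun i _ => le_daRound s R q _ i)
              ⟨j, Finset.mem_univ j, lt_of_le_of_ne (le_daRound s R q _ j) (Ne.symm hj)⟩
          omega
  rcases key (k * C) with h | h
  · exact h
  · have := Finset.sum_le_card_nsmul Finset.univ
      (fun j => ((daRound s R q)^[k * C + 1] (fun _ => 0)) j) C (fun j _ => hle _ j)
    simp only [Finset.card_univ, Fintype.card_fin, smul_eq_mul] at this
    omega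

/-- The per capita demand for college `c` at cutoffs `p`: the fraction of the `k` applicants whose
highest-ranked feasible college is `c`, where `c'` is feasible for `j` if `p c' ≤ s j c'`. -/
def demand (s : Fin k → Fin C → ℝ) (R : Fin k → ROL C) (p : Fin C → ℝ) (c : Fin C) : ℝ :=
  ((Finset.univ.filter
    (fun j : Fin k => (R j).1.find? (fun c' => p c' ≤ s j c') = some c)).card : ℝ) / k

end DeferredAcceptance

/-- The number of seats in the economy with `k` applicants: the integer nearest to `k * S c`,
rounded down in case of a tie. -/
def capacity {C : ℕ} (S : Fin C → ℝ) (k : ℕ) (c : Fin C) : ℕ := ⌈(k : ℝ) * S c - 1 / 2⌉₊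

/-- A step of the cutoff adjustment for a demand system `D` and capacities `S`: the cutoff of `c`
becomes the largest `x ∈ [0, 1]` at which the demand for `c` equals `S c`, the other cutoffs being
unchanged, and `0` if there is no such `x` (recall `sSup ∅ = 0`). -/
def cutoffStep {C : ℕ} (D : (Fin C → ℝ) → Fin C → ℝ) (S : Fin C → ℝ) (p : Fin C → ℝ) :
    Fin C → ℝ :=
  fun c => sSup {x : ℝ | x ∈ Set.Icc (0 : ℝ) 1 ∧ D (Function.update p c x) c = S c}

/-- `p` is the vector of deferred acceptance cutoffs of a demand system `D` with capacities `S`: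
the limit of the adjustment process that starts from zero cutoffs. -/
def IsLimitCutoff {C : ℕ} (D : (Fin C → ℝ) → Fin C → ℝ) (S : Fin C → ℝ) (p : Fin C → ℝ) : Prop :=
  Tendsto (fun m : ℕ => (cutoffStep D S)^[m] 0) atTop (𝓝 p)

section Economies

variable {C : ℕ} {a b : ℝ}

/-- The type distribution is absolutely continuous with respect to Lebesgue measure. -/
def HasDensity (η : Measure (ApplicantType C a b)) : Prop :=
  η.map (fun t => (t.utility, t.score)) ≪ (volume : Measure ((Fin C → ℝ) × (Fin C → ℝ)))

/-- Full support of the type distribution: it charges every open set of types that contains a type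
with nonnegative utilities. -/
def FullSupport (η : Measure (ApplicantType C a b)) : Prop :=
  ∀ U : Set (ApplicantType C a b), IsOpen U → (∃ t ∈ U, ∀ c, max a 0 ≤ t.utility c) → 0 < η U

/-- A strategy is a Markov kernel from types to rank-order lists, i.e. a measurable function from
types to lotteries over rank-order lists; a profile assigns one to every applicant. The profile is
`γ`-regular if every applicant, whatever her type, reports truthfully with probability at least
`γ`. -/
def IsRegularProfile (γ : ℝ) (σ : ℕ → Kernel (ApplicantType C a b) (ROL C)) : Prop :=
  0 < γ ∧ ∀ i t, γ ≤ (σ i t).real {truthfulROL t}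

/-- All applicants use the same strategy. -/
def IsSymmetricProfile (σ : ℕ → Kernel (ApplicantType C a b) (ROL C)) : Prop :=
  ∀ i j, σ i = σ j

/-- A realization of the sequence of random economies under the profile `σ`: in the economy with
`k` applicants, the types `T k j` are i.i.d. with law `η`, and applicant `j` submits a list `R k j`
drawn from `σ j (T k j)`, independently across applicants. Nothing is assumed on the dependence
between the economies for different `k`, so an applicant may keep her type and her list as the
economy grows, or the economies may be drawn independently. -/
structure IsRealization {Ω : Type*} [MeasurableSpace Ω] (μ : Measure Ω)
    (η : Measure (ApplicantType C a b)) (σ : ℕ → Kernel (ApplicantType C a b) (ROL C))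
    (T : (k : ℕ) → Fin k → Ω → ApplicantType C a b) (R : (k : ℕ) → Fin k → Ω → ROL C) : Prop where
  measurable_type : ∀ k j, Measurable (T k j)
  measurable_list : ∀ k j, Measurable (R k j)
  law : ∀ k (j : Fin k), μ.map (fun ω => (T k j ω, R k j ω)) = η ⊗ₘ σ j
  indep : ∀ k, iIndepFun (fun (j : Fin k) ω => (T k j ω, R k j ω)) μ

/-- The submitted lists of `k` applicants with types `t` when applicant `i` deviates to truthful
reporting and the others submit the lists `R`; `i = none` means that nobody deviates. -/
def deviate {k : ℕ} (i : Option ℕ) (t : Fin k → ApplicantType C a b) (R : Fin k → ROL C) :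
    Fin k → ROL C :=
  fun j => if i = some (j : ℕ) then truthfulROL (t j) else R j

/-- The random cutoffs `P` of the economy with `k` applicants when `i` deviates to truthful
reporting (nobody, if `i = none`). -/
def randomCutoff {Ω : Type*} (S : Fin C → ℝ) (T : (k : ℕ) → Fin k → Ω → ApplicantType C a b)
    (R : (k : ℕ) → Fin k → Ω → ROL C) (k : ℕ) (i : Option ℕ) (ω : Ω) : Fin C → ℝ :=
  daCutoff (fun j => (T k j ω).score)
    (deviate i (fun j => T k j ω) (fun j => R k j ω)) (capacity S k)

/-- The expected demand in the economy with `k` applicants when `i` deviates to truthful reporting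
(nobody, if `i = none`). -/
def expectedDemand {Ω : Type*} [MeasurableSpace Ω] (μ : Measure Ω)
    (T : (k : ℕ) → Fin k → Ω → ApplicantType C a b)
    (R : (k : ℕ) → Fin k → Ω → ROL C) (k : ℕ) (i : Option ℕ) (p : Fin C → ℝ) : Fin C → ℝ :=
  fun c => ∫ ω, demand (fun j => (T k j ω).score)
    (deviate i (fun j => T k j ω) (fun j => R k j ω)) p c ∂μ

end Economies

end

/-! With distinct scores and positive capacities, deferred acceptance gives every applicant her best
feasible college at its own cutoffs (`find?_daCutoff_eq_some_iff`). The random cutoffs therefore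
clear the market of the empirical demand, and the theorem becomes a stability statement for market
clearing cutoffs.

The empirical demand is close to the mean demand. A deviation changes one list, hence per capita
demand by at most `1 / k`, whoever deviates. At fixed cutoffs, Hoeffding's inequality and
Borel–Cantelli give almost sure convergence of the difference to zero; since the tail bounds are
summable, the dependence between economies plays no role. The mean demand involves only `η` and `σ`,
so its limits do not depend on the probability space.

Mean demands are equicontinuous because score hyperplanes are null, uniformly in the strategies
(`HasDensity.exists_abs_choiceSet_sub_le`), and Arzelà–Ascoli yields a uniformly convergent
subsequence; under symmetry the mean demand is the same for all `k ≥ 1`. Regularity and full support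
give a loss of aggregate demand, uniform over applicants, when cutoffs are raised
(`exists_pos_sum_choiceSet_add_le`), so strict monotonicity survives in the limit `D`.

Strict monotonicity and gross substitutes make the market clearing cutoffs of `D` unique
(`IsMarketClearing.eq`), and the monotone adjustment process converges to them. By compactness the
random cutoffs have cluster points, each of which clears the market of `D`
(`IsMarketClearing.tendsto`); hence they converge. Gross substitutes also reduce the convergence of
demand at moving cutoffs to convergence at rational ones, so countably many null sets suffice. -/

/-! ### Deferred acceptance outcomes as market clearing cutoffs -/

section DeferredAcceptanceCutoffs

theorem rank_lt_rank {α : Type*} (r : α → α → Prop) [IsStrictTotalOrder α r] [DecidableRel r]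
    {X : Finset α} {x y : α} (hx : x ∈ X) (h : r x y) :
    (X.filter (fun z => r z x)).card < (X.filter (fun z => r z y)).card := by
  refine Finset.card_lt_card ⟨fun z hz => ?_, fun hs => ?_⟩
  · simp only [Finset.mem_filter] at hz ⊢
    exact ⟨hz.1, trans_of r hz.2 h⟩
  · have := hs (Finset.mem_filter.2 ⟨hx, h⟩)
    exact irrefl_of r x (Finset.mem_filter.1 this).2

theorem rank_injOn {α : Type*} (r : α → α → Prop) [IsStrictTotalOrder α r] [DecidableRel r]
    (X : Finset α) : Set.InjOn (fun x => (X.filter (fun z => r z x)).card) X := by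
  intro x hx y hy hxy
  rcases trichotomous_of r x y with h | h | h
  · exact absurd hxy (rank_lt_rank r hx h).ne
  · exact h
  · exact absurd hxy (rank_lt_rank r hy h).ne'

/-- At least `min q #X` elements of `X` have fewer than `q` elements of `X` above them. -/
theorem min_le_card_filter_rank_lt {α : Type*} (r : α → α → Prop) [IsStrictTotalOrder α r]
    [DecidableRel r] (X : Finset α) (q : ℕ) :
    min q X.card ≤ (X.filter (fun x => (X.filter (fun z => r z x)).card < q)).card := by
  have h1 := X.card_filter_add_card_filter_not
    (fun x => (X.filter (fun z => r z x)).card < q)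
  have h2 : (X.filter (fun x => ¬ (X.filter (fun z => r z x)).card < q)).card
      ≤ (Finset.Ico q X.card).card := by
    -- The rank maps the elements with at least `q` others above them injectively into `[q, #X)`.
    refine Finset.card_le_card_of_injOn (fun x => (X.filter (fun z => r z x)).card) ?_
      ((rank_injOn r X).mono (Finset.coe_subset.2 (Finset.filter_subset _ _)))
    intro x hx
    simp only [Finset.coe_filter, Set.mem_ofPred_eq, not_lt] at hx
    simp only [Finset.coe_Ico, Set.mem_Ico]
    refine ⟨hx.2, Finset.card_lt_card ⟨Finset.filter_subset _ _, fun hs => ?_⟩⟩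
    exact irrefl_of r x (Finset.mem_filter.1 (hs hx.1)).2
  rw [Nat.card_Ico] at h2
  omega

theorem card_le_of_forall_rank_lt {α : Type*} (r : α → α → Prop) [IsStrictTotalOrder α r]
    [DecidableRel r] (X : Finset α) (q : ℕ)
    (h : ∀ x ∈ X, (X.filter (fun z => r z x)).card < q) : X.card ≤ q := by
  have := Finset.card_le_card_of_injOn (s := X) (t := Finset.range q)
    (fun x => (X.filter (fun z => r z x)).card) (fun x hx => by simpa using h x hx)
    (rank_injOn r X)
  simpa using this

variable {k C : ℕ}

instance isStrictTotalOrder_rankedAbove (s : Fin k → Fin C → ℝ) (c : Fin C) :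
    IsStrictTotalOrder (Fin k) (RankedAbove s c) where
  irrefl j h := by rcases h with h | h <;> simp at h
  trans i j l h1 h2 := by
    unfold RankedAbove at *
    rcases h1 with h1 | ⟨h1, h1'⟩ <;> rcases h2 with h2 | ⟨h2, h2'⟩
    · exact Or.inl (h2.trans h1)
    · exact Or.inl (by linarith)
    · exact Or.inl (by linarith)
    · exact Or.inr ⟨h1.trans h2, h1'.trans h2'⟩
  trichotomous i j h1 h2 := by
    unfold RankedAbove at h1 h2
    push Not at h1 h2
    have : s i c = s j c := le_antisymm h1.1 h2.1
    exact le_antisymm (h2.2 this.symm) (h1.2 this)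

open Classical in
-- The best `q c` of the pool members above `j` each have fewer than `q c` pool members above them,
-- so none of them is rejected in this round. This invariant makes rejections final.
theorem le_card_rankedAbove_daRound (s : Fin k → Fin C → ℝ) (R : Fin k → ROL C)
    (q : Fin C → ℕ) (n : Fin k → ℕ) (c : Fin C) (j : Fin k)
    (h : q c ≤ ((applicantPool R n c).filter (fun j' => RankedAbove s c j' j)).card) :
    q c ≤ ((applicantPool R (daRound s R q n) c).filter
      (fun j' => RankedAbove s c j' j)).card := by
  set A := (applicantPool R n c).filter (fun j' => RankedAbove s c j' j) with hA
  have h1 := min_le_card_filter_rank_lt (RankedAbove s c) A (q c)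
  rw [min_eq_left h] at h1
  refine h1.trans (Finset.card_le_card fun x hx => ?_)
  obtain ⟨hxA, hx⟩ := Finset.mem_filter.1 hx
  obtain ⟨hxp, hxj⟩ := Finset.mem_filter.1 hxA
  refine Finset.mem_filter.2 ⟨?_, hxj⟩
  have hnr : ¬ IsRejected s R q n x := by
    rintro ⟨c', hc', hq⟩
    have hcc : c' = c := by
      simp only [applicantPool, Finset.mem_filter] at hc' hxp
      exact Option.some.inj (hc'.2.symm.trans hxp.2)
    subst hcc
    have : (applicantPool R n c').filter (fun j' => RankedAbove s c' j' x)
        ⊆ A.filter (fun j' => RankedAbove s c' j' x) := by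
      intro y hy
      simp only [hA, Finset.mem_filter] at hy ⊢
      exact ⟨⟨hy.1, trans_of (RankedAbove s c') hy.2 hxj⟩, hy.2⟩
    have := Finset.card_le_card this
    omega
  simp only [applicantPool, Finset.mem_filter, Finset.mem_univ, true_and] at hxp ⊢
  rw [daRound, if_neg hnr]
  exact hxp

open Classical in
/-- At every round, the seats of a college that has rejected `j` can be filled with applicants
ranked above `j`. -/
theorem le_card_rankedAbove_of_rejected (s : Fin k → Fin C → ℝ) (R : Fin k → ROL C)
    (q : Fin C → ℕ) (m : ℕ) (j : Fin k) (i : ℕ) (c : Fin C)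
    (hi : i < ((daRound s R q)^[m] (fun _ => 0)) j) (hc : (R j).1[i]? = some c) :
    q c ≤ ((applicantPool R ((daRound s R q)^[m] (fun _ => 0)) c).filter
      (fun j' => RankedAbove s c j' j)).card := by
  induction m with
  | zero => simp at hi
  | succ m ih =>
    rw [Function.iterate_succ_apply'] at hi ⊢
    apply le_card_rankedAbove_daRound
    by_cases h : i < ((daRound s R q)^[m] (fun _ => 0)) j
    · exact ih h
    · rw [daRound] at hi
      split_ifs at hi with hr
      · obtain ⟨c', hc', hq⟩ := hr
        have : i = ((daRound s R q)^[m] (fun _ => 0)) j := by omega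
        have hcc : c' = c := by
          simp only [applicantPool, Finset.mem_filter] at hc'
          rw [← this] at hc'
          exact Option.some.inj (hc'.2.symm.trans hc)
        exact hcc ▸ hq
      · exact absurd hi h

/-- The final state is a fixed point, so nobody is rejected there: every matched applicant has fewer
than `q c` matched applicants above her. -/
theorem card_daMatched_le (s : Fin k → Fin C → ℝ) (R : Fin k → ROL C) (q : Fin C → ℕ)
    (c : Fin C) : (daMatched s R q c).card ≤ q c := by
  classical
  refine card_le_of_forall_rank_lt (RankedAbove s c) _ _ fun j hj => ?_
  by_contra! hq
  have hr : IsRejected s R q (daFinal s R q) j := ⟨c, hj, hq⟩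
  have := congrFun (daRound_daFinal s R q) j
  rw [daRound, if_pos hr] at this
  omega

theorem daCutoff_le_score (s : Fin k → Fin C → ℝ) (R : Fin k → ROL C) (q : Fin C → ℕ)
    (hs : ∀ j c, 0 ≤ s j c) {c : Fin C} {j : Fin k} (hj : j ∈ daMatched s R q c) :
    daCutoff s R q c ≤ s j c := by
  unfold daCutoff
  split_ifs with h1 h2
  · exact hs j c
  · exact Finset.inf'_le (fun j => s j c) hj
  · exact absurd ⟨j, hj⟩ h2

/-- The matched applicants above `j` already fill the college, so all matched applicants are above
`j`. Distinct scores exclude the tie-break by index, and a positive capacity makes the cutoff a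
minimum over a nonempty set. -/
theorem score_lt_daCutoff_of_rejected (s : Fin k → Fin C → ℝ) (R : Fin k → ROL C)
    (q : Fin C → ℕ) (hinj : ∀ c, Function.Injective fun j => s j c) {c : Fin C} (hq : 0 < q c)
    {j : Fin k} {i : ℕ} (hi : i < daFinal s R q j) (hc : (R j).1[i]? = some c) :
    s j c < daCutoff s R q c := by
  classical
  have h1 := le_card_rankedAbove_of_rejected s R q (k * C) j i c hi hc
  have h2 : ((daMatched s R q c).filter (fun j' => RankedAbove s c j' j)) = daMatched s R q c := by
    refine Finset.eq_of_subset_of_card_le (Finset.filter_subset _ _)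
      ((card_daMatched_le s R q c).trans h1)
  have h3 : q c ≤ (daMatched s R q c).card := by
    rw [← h2]; exact h1
  have h4 : (daMatched s R q c).Nonempty := Finset.card_pos.1 (by omega)
  rw [daCutoff, if_neg (by omega), dif_pos h4, Finset.lt_inf'_iff]
  intro x hx
  rw [← h2] at hx
  rcases (Finset.mem_filter.1 hx).2 with h | ⟨h, h'⟩
  · exact h
  · exact absurd (hinj c h) h'.ne

/-- With distinct scores and positive capacities, deferred acceptance matches every applicant with
her highest-ranked feasible college at the cutoffs of the outcome. -/
theorem find?_daCutoff_eq_some_iff (s : Fin k → Fin C → ℝ) (R : Fin k → ROL C) (q : Fin C → ℕ)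
    (hs : ∀ j c, 0 ≤ s j c) (hinj : ∀ c, Function.Injective fun j => s j c)
    (hq : ∀ c, 0 < q c) (j : Fin k) (c : Fin C) :
    (R j).1.find? (fun c' => daCutoff s R q c' ≤ s j c') = some c ↔ j ∈ daMatched s R q c := by
  have hmem : ∀ c, j ∈ daMatched s R q c ↔ (R j).1[daFinal s R q j]? = some c := by
    intro c; simp [daMatched, applicantPool]
  rw [List.find?_eq_some_iff_getElem]
  constructor
  · rintro ⟨hf, i, hi, hic, hlt⟩
    have hf' : daCutoff s R q c ≤ s j c := by simpa using hf
    rcases lt_trichotomy i (daFinal s R q j) with h | h | h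
    · exact absurd hf' (not_le.2 (score_lt_daCutoff_of_rejected s R q hinj (hq c) h
        (List.getElem?_eq_some_iff.2 ⟨hi, hic⟩)))
    · rw [hmem, ← h]; exact List.getElem?_eq_some_iff.2 ⟨hi, hic⟩
    -- Otherwise `j` would be held by a college listed before `c`, which would then be feasible for
    -- her.
    · have h1 := hlt _ h
      have h2 : j ∈ daMatched s R q ((R j).1[daFinal s R q j]) := by
        rw [hmem]; exact List.getElem?_eq_some_iff.2 ⟨h.trans hi, rfl⟩
      have h3 := daCutoff_le_score s R q hs h2
      simp only [Bool.not_eq_true', decide_eq_false_iff_not] at h1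
      exact absurd h3 h1
  · intro hj
    obtain ⟨hi, hic⟩ := List.getElem?_eq_some_iff.1 ((hmem c).1 hj)
    refine ⟨by simpa using daCutoff_le_score s R q hs hj, _, hi, hic, fun i hilt => ?_⟩
    simp only [Bool.not_eq_true', decide_eq_false_iff_not, not_le]
    exact score_lt_daCutoff_of_rejected s R q hinj (hq _) hilt
      (List.getElem?_eq_some_iff.2 ⟨hilt.trans hi, rfl⟩)

theorem demand_daCutoff (s : Fin k → Fin C → ℝ) (R : Fin k → ROL C) (q : Fin C → ℕ)
    (hs : ∀ j c, 0 ≤ s j c) (hinj : ∀ c, Function.Injective fun j => s j c)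
    (hq : ∀ c, 0 < q c) (c : Fin C) :
    demand s R (daCutoff s R q) c = ((daMatched s R q c).card : ℝ) / k := by
  unfold demand
  congr 3
  ext j
  simp [find?_daCutoff_eq_some_iff s R q hs hinj hq]

theorem demand_daCutoff_le (s : Fin k → Fin C → ℝ) (R : Fin k → ROL C) (q : Fin C → ℕ)
    (hs : ∀ j c, 0 ≤ s j c) (hinj : ∀ c, Function.Injective fun j => s j c)
    (hq : ∀ c, 0 < q c) (c : Fin C) :
    demand s R (daCutoff s R q) c ≤ (q c : ℝ) / k := by
  rw [demand_daCutoff s R q hs hinj hq]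
  gcongr
  exact card_daMatched_le s R q c

theorem demand_daCutoff_eq (s : Fin k → Fin C → ℝ) (R : Fin k → ROL C) (q : Fin C → ℕ)
    (hs : ∀ j c, 0 ≤ s j c) (hinj : ∀ c, Function.Injective fun j => s j c)
    (hq : ∀ c, 0 < q c) (c : Fin C) (hc : 0 < daCutoff s R q c) :
    demand s R (daCutoff s R q) c = (q c : ℝ) / k := by
  rw [demand_daCutoff s R q hs hinj hq]
  have h : ¬ (daMatched s R q c).card < q c := fun h => by
    rw [daCutoff, if_pos h] at hc; exact hc.false
  rw [le_antisymm (card_daMatched_le s R q c) (not_lt.1 h)]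

theorem daCutoff_mem_Icc (s : Fin k → Fin C → ℝ) (R : Fin k → ROL C) (q : Fin C → ℕ)
    (hs : ∀ j c, s j c ∈ Set.Icc (0 : ℝ) 1) : daCutoff s R q ∈ Set.Icc (0 : Fin C → ℝ) 1 := by
  suffices h : ∀ c, daCutoff s R q c ∈ Set.Icc (0 : ℝ) 1 from ⟨fun c => (h c).1, fun c => (h c).2⟩
  intro c
  unfold daCutoff
  split_ifs with h1 h2
  · simp
  · obtain ⟨j, -, hj⟩ := Finset.exists_mem_eq_inf' h2 (fun j => s j c)
    rw [hj]; exact hs j c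
  · simp

end DeferredAcceptanceCutoffs

/-! ### Demand systems: uniqueness, existence and stability of market clearing cutoffs -/

section DemandSystems

variable {C : ℕ}

/-- Gross substitutes: on the unit cube, the demand for a college is antitone in its own cutoff and
monotone in the other cutoffs. -/
def GrossSubstitutes (D : (Fin C → ℝ) → Fin C → ℝ) : Prop :=
  ∀ c p q, p ∈ Set.Icc (0 : Fin C → ℝ) 1 → q ∈ Set.Icc (0 : Fin C → ℝ) 1 →
    q c ≤ p c → (∀ c' ≠ c, p c' ≤ q c') → D p c ≤ D q c

/-- A continuous demand system on the unit cube with gross substitutes, in which raising a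
nonempty set of cutoffs strictly lowers the aggregate demand for the colleges concerned. -/
structure IsDemandSystem (D : (Fin C → ℝ) → Fin C → ℝ) : Prop where
  continuousOn : ContinuousOn D (Set.Icc 0 1)
  grossSubstitutes : GrossSubstitutes D
  eq_zero : ∀ c, ∀ p ∈ Set.Icc (0 : Fin C → ℝ) 1, p c = 1 → D p c = 0
  strict : ∀ p ∈ Set.Icc (0 : Fin C → ℝ) 1, ∀ q ∈ Set.Icc (0 : Fin C → ℝ) 1, p ≤ q → p ≠ q →
    ∑ c with p c < q c, D q c < ∑ c with p c < q c, D p c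

/-- The cutoffs `p` clear the market: no college is over-demanded, and the colleges with a positive
cutoff fill their capacity. -/
def IsMarketClearing (D : (Fin C → ℝ) → Fin C → ℝ) (S p : Fin C → ℝ) : Prop :=
  ∀ c, D p c ≤ S c ∧ (0 < p c → D p c = S c)

variable {D : (Fin C → ℝ) → Fin C → ℝ} {S : Fin C → ℝ}

/-- Compare `p` with `p ⊔ p'`. At a college with `p c < p' c`, passing from `p'` to the join raises
only other cutoffs, so demand at the join is at least `S c`, hence at least the demand at `p`.
Summing over these colleges contradicts strictness. -/
theorem IsMarketClearing.le (hD : IsDemandSystem D) {p p' : Fin C → ℝ}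
    (hp : p ∈ Set.Icc (0 : Fin C → ℝ) 1) (hp' : p' ∈ Set.Icc (0 : Fin C → ℝ) 1)
    (h : IsMarketClearing D S p) (h' : IsMarketClearing D S p') : p' ≤ p := by
  by_contra hne
  have hq : p ⊔ p' ∈ Set.Icc (0 : Fin C → ℝ) 1 := ⟨hp.1.trans le_sup_left, sup_le hp.2 hp'.2⟩
  have hstrict := hD.strict p hp (p ⊔ p') hq le_sup_left
    (fun he => hne (he ▸ le_sup_right))
  refine absurd hstrict (not_lt.2 (Finset.sum_le_sum fun c hc => ?_))
  have hc' : p c < p' c := by simpa using hc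
  have h0 : 0 < p' c := (hp.1 c).trans_lt hc'
  calc D p c ≤ S c := (h c).1
    _ = D p' c := ((h' c).2 h0).symm
    _ ≤ D (p ⊔ p') c := hD.grossSubstitutes c _ _ hp' hq (by simp [hc'.le]) (fun d _ => by simp)

/-- Market clearing cutoffs are unique. -/
theorem IsMarketClearing.eq (hD : IsDemandSystem D) {p p' : Fin C → ℝ}
    (hp : p ∈ Set.Icc (0 : Fin C → ℝ) 1) (hp' : p' ∈ Set.Icc (0 : Fin C → ℝ) 1)
    (h : IsMarketClearing D S p) (h' : IsMarketClearing D S p') : p' = p :=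
  le_antisymm (h.le hD hp hp' h') (h'.le hD hp' hp h)

theorem update_mem_Icc {p : Fin C → ℝ} (hp : p ∈ Set.Icc (0 : Fin C → ℝ) 1) (c : Fin C) {x : ℝ}
    (hx : x ∈ Set.Icc (0 : ℝ) 1) : Function.update p c x ∈ Set.Icc (0 : Fin C → ℝ) 1 := by
  constructor <;> intro d <;> rcases eq_or_ne d c with rfl | h
  · simpa using hx.1
  · simpa [h] using hp.1 d
  · simpa using hx.2
  · simpa [h] using hp.2 d

theorem IsDemandSystem.continuousOn_update (hD : IsDemandSystem D) {p : Fin C → ℝ}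
    (hp : p ∈ Set.Icc (0 : Fin C → ℝ) 1) (c : Fin C) :
    ContinuousOn (fun x => D (Function.update p c x) c) (Set.Icc 0 1) := by
  have h : ContinuousOn (fun x => D (Function.update p c x)) (Set.Icc 0 1) :=
    hD.continuousOn.comp (by fun_prop) (fun x hx => update_mem_Icc hp c hx)
  exact (continuous_apply c).comp_continuousOn h

theorem cutoffStep_mem_Icc (D : (Fin C → ℝ) → Fin C → ℝ) (S p : Fin C → ℝ) :
    cutoffStep D S p ∈ Set.Icc (0 : Fin C → ℝ) 1 :=
  ⟨fun _ => Real.sSup_nonneg fun _ hx => hx.1.1,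
    fun _ => Real.sSup_le (fun _ hx => hx.1.2) zero_le_one⟩

/-- If the demand for `c` at the cutoff `x` is at least `S c`, then it equals `S c` at some higher
cutoff. -/
theorem IsDemandSystem.exists_eq (hD : IsDemandSystem D) (hS : ∀ c, 0 < S c) {p : Fin C → ℝ}
    (hp : p ∈ Set.Icc (0 : Fin C → ℝ) 1) (c : Fin C) {x : ℝ} (hx : x ∈ Set.Icc (0 : ℝ) 1)
    (h : S c ≤ D (Function.update p c x) c) :
    ∃ y ∈ Set.Icc x 1, D (Function.update p c y) c = S c := by
  have h1 : D (Function.update p c 1) c = 0 :=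
    hD.eq_zero c _ (update_mem_Icc hp c (by simp)) (by simp)
  have := intermediate_value_Icc' hx.2
    ((hD.continuousOn_update hp c).mono (Set.Icc_subset_Icc_left hx.1))
  exact this ⟨h1.trans_le (hS c).le, h⟩

theorem IsDemandSystem.le_cutoffStep (hD : IsDemandSystem D) (hS : ∀ c, 0 < S c) {p : Fin C → ℝ}
    (hp : p ∈ Set.Icc (0 : Fin C → ℝ) 1) (c : Fin C) {x : ℝ} (hx : x ∈ Set.Icc (0 : ℝ) 1)
    (h : S c ≤ D (Function.update p c x) c) : x ≤ cutoffStep D S p c := by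
  obtain ⟨y, hy, hyS⟩ := hD.exists_eq hS hp c hx h
  exact hy.1.trans (le_csSup ⟨1, fun z hz => hz.1.2⟩ ⟨⟨hx.1.trans hy.1, hy.2⟩, hyS⟩)

/-- By continuity the solution set is closed, so a nonempty one contains its supremum. If it is
empty, excess demand at cutoff `0` is impossible, since demand vanishes at cutoff `1` and would
cross `S c`. -/
theorem IsDemandSystem.cutoffStep_spec (hD : IsDemandSystem D) (hS : ∀ c, 0 < S c)
    {p : Fin C → ℝ} (hp : p ∈ Set.Icc (0 : Fin C → ℝ) 1) (c : Fin C) :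
    D (Function.update p c (cutoffStep D S p c)) c ≤ S c ∧
      (0 < cutoffStep D S p c → D (Function.update p c (cutoffStep D S p c)) c = S c) := by
  rcases Set.eq_empty_or_nonempty
    {x : ℝ | x ∈ Set.Icc (0 : ℝ) 1 ∧ D (Function.update p c x) c = S c} with he | hne
  · have h0 : cutoffStep D S p c = 0 := by rw [cutoffStep, he, Real.sSup_empty]
    rw [h0]
    refine ⟨?_, fun h => absurd h (lt_irrefl _)⟩
    by_contra! hlt
    obtain ⟨y, hy, hyS⟩ := hD.exists_eq hS hp c (x := 0) (by simp) hlt.le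
    exact (Set.eq_empty_iff_forall_notMem.1 he y) ⟨hy, hyS⟩
  · have hcl : IsClosed {x : ℝ | x ∈ Set.Icc (0 : ℝ) 1 ∧ D (Function.update p c x) c = S c} :=
      (hD.continuousOn_update hp c).preimage_isClosed_of_isClosed isClosed_Icc
        (isClosed_singleton (x := S c))
    have := (hcl.csSup_mem hne ⟨1, fun z hz => hz.1.2⟩).2
    exact ⟨this.le, fun _ => this⟩

/-- Raising the other cutoffs leaves the demand at the old value of the step at least `S c`, so
there is a solution at or above that value. -/
theorem IsDemandSystem.cutoffStep_mono (hD : IsDemandSystem D) (hS : ∀ c, 0 < S c)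
    {p q : Fin C → ℝ} (hp : p ∈ Set.Icc (0 : Fin C → ℝ) 1) (hq : q ∈ Set.Icc (0 : Fin C → ℝ) 1)
    (hpq : p ≤ q) : cutoffStep D S p ≤ cutoffStep D S q := by
  intro c
  have hm : cutoffStep D S p c ∈ Set.Icc (0 : ℝ) 1 :=
    ⟨(cutoffStep_mem_Icc D S p).1 c, (cutoffStep_mem_Icc D S p).2 c⟩
  rcases hm.1.eq_or_lt with h0 | h0
  · rw [← h0]; exact (cutoffStep_mem_Icc D S q).1 c
  · refine hD.le_cutoffStep hS hq c hm ?_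
    rw [← (hD.cutoffStep_spec hS hp c).2 h0]
    refine hD.grossSubstitutes c _ _ (update_mem_Icc hp c hm) (update_mem_Icc hq c hm)
      (by simp) (fun d hd => ?_)
    simpa [hd] using hpq d

/-- The cutoff adjustment converges, and its limit clears the market. -/
theorem IsDemandSystem.exists_isLimitCutoff (hD : IsDemandSystem D) (hS : ∀ c, 0 < S c) :
    ∃ p ∈ Set.Icc (0 : Fin C → ℝ) 1, IsLimitCutoff D S p ∧ IsMarketClearing D S p := by
  set P : ℕ → Fin C → ℝ := fun m => (cutoffStep D S)^[m] 0 with hP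
  have hsucc : ∀ m, P (m + 1) = cutoffStep D S (P m) := fun m =>
    Function.iterate_succ_apply' _ _ _
  have hmem : ∀ m, P m ∈ Set.Icc (0 : Fin C → ℝ) 1 := by
    intro m
    cases m with
    | zero => exact ⟨le_rfl, zero_le_one⟩
    | succ m => rw [hsucc]; exact cutoffStep_mem_Icc D S _
  have hmono : Monotone P := by
    refine monotone_nat_of_le_succ fun m => ?_
    induction m with
    | zero => exact (hmem 1).1
    | succ m ih => rw [hsucc, hsucc]; exact hD.cutoffStep_mono hS (hmem _) (hmem _) ih
  have hlim : Tendsto P atTop (𝓝 (⨆ m, P m)) :=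
    tendsto_atTop_ciSup hmono ⟨1, by rintro _ ⟨m, rfl⟩; exact (hmem m).2⟩
  set p := ⨆ m, P m
  have hp : p ∈ Set.Icc (0 : Fin C → ℝ) 1 :=
    isClosed_Icc.mem_of_tendsto hlim (Eventually.of_forall hmem)
  refine ⟨p, hp, hlim, fun c => ?_⟩
  have hlim' : Tendsto (fun m => P (m + 1)) atTop (𝓝 p) := (tendsto_add_atTop_iff_nat 1).2 hlim
  have hlc : Tendsto (fun m => P (m + 1) c) atTop (𝓝 (p c)) := (tendsto_pi_nhds.1 hlim') c
  have hcm : ∀ m, P (m + 1) c ∈ Set.Icc (0 : ℝ) 1 := fun m => ⟨(hmem _).1 c, (hmem _).2 c⟩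
  -- The step for `c` solves an equation at the old cutoffs with only coordinate `c` renewed; these
  -- mixed vectors have the same limit `p`, so the equation passes to the limit.
  have hupd : Tendsto (fun m => Function.update (P m) c (P (m + 1) c)) atTop
      (𝓝[Set.Icc 0 1] p) := by
    refine tendsto_nhdsWithin_iff.2 ⟨?_, Eventually.of_forall fun m =>
      update_mem_Icc (hmem m) c (hcm m)⟩
    have := hlim.update c hlc
    rwa [Function.update_eq_self] at this
  have hDl : Tendsto (fun m => D (Function.update (P m) c (P (m + 1) c)) c) atTop (𝓝 (D p c)) :=
    (tendsto_pi_nhds.1 ((hD.continuousOn p hp).tendsto.comp hupd)) c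
  have hspec := fun m => hD.cutoffStep_spec hS (hmem m) c
  simp only [← hsucc] at hspec
  refine ⟨le_of_tendsto hDl (Eventually.of_forall fun m => (hspec m).1), fun h0 => ?_⟩
  refine tendsto_nhds_unique hDl (tendsto_const_nhds.congr' ?_)
  filter_upwards [hlc.eventually (lt_mem_nhds h0)] with m hm
  exact ((hspec m).2 hm).symm

/-- A rational point of the unit interval between `max 0 (x - δ)` and `x`, and one between `x` and
`min 1 (x + δ)`. -/
theorem exists_rat_bracket {x δ : ℝ} (hx : x ∈ Set.Icc (0 : ℝ) 1) (hδ : 0 < δ) :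
    ∃ l u : ℚ, (l : ℝ) ∈ Set.Icc (0 : ℝ) 1 ∧ (u : ℝ) ∈ Set.Icc (0 : ℝ) 1 ∧ |l - x| ≤ δ ∧
      |u - x| ≤ δ ∧ (∀ᶠ y in 𝓝[Set.Icc 0 1] x, (l : ℝ) ≤ y ∧ y ≤ u) := by
  obtain ⟨l, hl, hl'⟩ := exists_rat_btwn (sub_lt_self x hδ)
  obtain ⟨u, hu, hu'⟩ := exists_rat_btwn (lt_add_of_pos_right x hδ)
  refine ⟨max l 0, min u 1, ⟨by simp, ?_⟩, ⟨?_, by simp⟩, ?_, ?_, ?_⟩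
  · push_cast; exact max_le (hl'.le.trans hx.2) zero_le_one
  · push_cast; exact le_min (hx.1.trans hu.le) zero_le_one
  · push_cast
    rw [abs_le]
    constructor
    · linarith [le_max_left (l : ℝ) 0]
    · linarith [max_le hl'.le hx.1]
  · push_cast
    rw [abs_le]
    constructor
    · linarith [le_min hu.le hx.2]
    · linarith [min_le_left (u : ℝ) 1]
  · filter_upwards [self_mem_nhdsWithin, nhdsWithin_le_nhds (Icc_mem_nhds hl' hu)] with y hy hy'
    push_cast
    exact ⟨max_le hy'.1 hy.1, le_min hy'.2 hy.2⟩

/-- Demand systems with gross substitutes that converge at rational points to a continuous limit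
converge continuously. -/
theorem tendsto_apply_of_grossSubstitutes {ι : Type*} {L : Filter ι}
    (hD : ContinuousOn D (Set.Icc 0 1)) {f : ι → (Fin C → ℝ) → Fin C → ℝ}
    (hf : ∀ i, GrossSubstitutes (f i))
    (hlim : ∀ r : Fin C → ℚ, (fun c => (r c : ℝ)) ∈ Set.Icc (0 : Fin C → ℝ) 1 →
      Tendsto (fun i => f i (fun c => (r c : ℝ))) L (𝓝 (D fun c => (r c : ℝ))))
    {P : ι → Fin C → ℝ} (hP : ∀ i, P i ∈ Set.Icc (0 : Fin C → ℝ) 1) {p : Fin C → ℝ}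
    (hp : p ∈ Set.Icc (0 : Fin C → ℝ) 1) (hPp : Tendsto P L (𝓝 p)) :
    Tendsto (fun i => f i (P i)) L (𝓝 (D p)) := by
  refine tendsto_pi_nhds.2 fun c => ?_
  rw [Metric.tendsto_nhds]
  intro ε hε
  obtain ⟨δ, hδ, hδD⟩ := Metric.continuousWithinAt_iff.1 (hD p hp) (ε / 2) (by positivity)
  choose l u hl hu hlp hup hev using fun d : Fin C =>
    exists_rat_bracket (x := p d) ⟨hp.1 d, hp.2 d⟩ (half_pos hδ)
  have hclose : ∀ r : Fin C → ℚ, (∀ d, r d = l d ∨ r d = u d) →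
      (fun c => (r c : ℝ)) ∈ Set.Icc (0 : Fin C → ℝ) 1 ∧
      ∀ᶠ i in L, dist (f i (fun c => (r c : ℝ)) c) (D p c) < ε := by
    intro r hr
    have hmem : (fun c => (r c : ℝ)) ∈ Set.Icc (0 : Fin C → ℝ) 1 := by
      constructor <;> intro d <;> rcases hr d with h | h <;> simp only [h]
      · exact (hl d).1
      · exact (hu d).1
      · exact (hl d).2
      · exact (hu d).2
    refine ⟨hmem, ?_⟩
    have h1 : dist (fun c => (r c : ℝ)) p < δ := by
      refine lt_of_le_of_lt ((dist_pi_le_iff (by positivity)).2 fun d => ?_) (half_lt_self hδ)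
      rw [Real.dist_eq]
      rcases hr d with h | h <;> rw [h]
      · exact hlp d
      · exact hup d
    have h2 := (dist_le_pi_dist _ _ c).trans_lt (hδD hmem h1)
    filter_upwards [(Metric.tendsto_nhds.1 ((tendsto_pi_nhds.1 (hlim r hmem)) c)) (ε / 2)
      (by positivity)] with i hi
    linarith [dist_triangle (f i (fun c => (r c : ℝ)) c) (D (fun c => (r c : ℝ)) c) (D p c)]
  -- The corner with own cutoff high and the others low bounds the demand for `c` from below; the
  -- opposite corner bounds it from above.
  obtain ⟨hlo, hlo'⟩ := hclose (fun d => if d = c then u d else l d) (fun d => by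
    by_cases h : d = c <;> simp [h])
  obtain ⟨hhi, hhi'⟩ := hclose (fun d => if d = c then l d else u d) (fun d => by
    by_cases h : d = c <;> simp [h])
  have hbr : ∀ᶠ i in L, ∀ d, (l d : ℝ) ≤ P i d ∧ P i d ≤ u d := by
    refine eventually_all.2 fun d => ?_
    have : Tendsto (fun i => P i d) L (𝓝[Set.Icc 0 1] (p d)) :=
      tendsto_nhdsWithin_iff.2 ⟨(tendsto_pi_nhds.1 hPp) d,
        Eventually.of_forall fun i => ⟨(hP i).1 d, (hP i).2 d⟩⟩
    exact this.eventually (hev d)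
  filter_upwards [hlo', hhi', hbr] with i h1 h2 h3
  rw [Real.dist_eq, abs_lt] at h1 h2 ⊢
  have h4 := hf i c _ (P i) hlo (hP i) (by simpa using (h3 c).2)
    (fun d hd => by simpa [hd] using (h3 d).1)
  have h5 := hf i c (P i) _ (hP i) hhi (by simpa using (h3 c).1)
    (fun d hd => by simpa [hd] using (h3 d).2)
  constructor <;> linarith [h1.1, h2.2]

/-- Cutoffs that clear the market of demand systems converging to `D` converge to the market
clearing cutoffs of `D`. -/
theorem IsMarketClearing.tendsto (hD : IsDemandSystem D) {p : Fin C → ℝ}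
    (hp : p ∈ Set.Icc (0 : Fin C → ℝ) 1) (hmc : IsMarketClearing D S p)
    {ι : Type*} {L : Filter ι} {f : ι → (Fin C → ℝ) → Fin C → ℝ}
    (hf : ∀ i, GrossSubstitutes (f i))
    (hlim : ∀ r : Fin C → ℚ, (fun c => (r c : ℝ)) ∈ Set.Icc (0 : Fin C → ℝ) 1 →
      Tendsto (fun i => f i (fun c => (r c : ℝ))) L (𝓝 (D fun c => (r c : ℝ))))
    {q P : ι → Fin C → ℝ} (hq : Tendsto q L (𝓝 S))
    (hP : ∀ i, P i ∈ Set.Icc (0 : Fin C → ℝ) 1)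
    (hclear : ∀ᶠ i in L, IsMarketClearing (f i) (q i) (P i)) : Tendsto P L (𝓝 p) := by
  refine isCompact_Icc.tendsto_nhds_of_unique_mapClusterPt (Eventually.of_forall hP)
    fun y hy hcl => ?_
  -- Along an ultrafilter on which `P` tends to the cluster point `y`, the market clearing
  -- conditions pass to the limit, so uniqueness identifies `y`.
  obtain ⟨U, hUL, hUy⟩ := mapClusterPt_iff_ultrafilter.1 hcl
  refine hmc.eq hD hp hy fun c => ?_
  have h1 := (tendsto_pi_nhds.1 (tendsto_apply_of_grossSubstitutes hD.continuousOn hf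
    (fun r hr => (hlim r hr).mono_left hUL) hP hy hUy)) c
  have h2 := (tendsto_pi_nhds.1 (hq.mono_left hUL)) c
  refine ⟨le_of_tendsto_of_tendsto h1 h2 ?_, fun h0 => tendsto_nhds_unique_of_eventuallyEq h1 h2 ?_⟩
  · filter_upwards [hUL hclear] with i hi using (hi c).1
  · filter_upwards [hUL hclear, ((tendsto_pi_nhds.1 hUy) c).eventually (lt_mem_nhds h0)]
      with i hi hi' using (hi c).2 hi'

end DemandSystems

/-! ### Individual choice at given cutoffs and its measurability -/

section Choice

variable {C : ℕ}

/-- The highest-ranked feasible college of an applicant with list `r` and scores `x` at the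
cutoffs `p`. -/
noncomputable def choice (r : ROL C) (x p : Fin C → ℝ) : Option (Fin C) :=
  r.1.find? (fun c => p c ≤ x c)

theorem choice_eq_some_iff {r : ROL C} {x p : Fin C → ℝ} {c : Fin C} :
    choice r x p = some c ↔
      p c ≤ x c ∧ ∃ i, ∃ h : i < r.1.length, r.1[i] = c ∧ ∀ j (hj : j < i), x r.1[j] < p r.1[j] := by
  simp [choice, List.find?_eq_some_iff_getElem]

/-- The colleges listed before `c` are infeasible at `p`, hence different from `c`, and stay
infeasible when their cutoffs rise. -/
theorem choice_eq_some_of_le {r : ROL C} {x p q : Fin C → ℝ} {c : Fin C} (hc : q c ≤ p c)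
    (h : ∀ d ≠ c, p d ≤ q d) (hp : choice r x p = some c) : choice r x q = some c := by
  rw [choice_eq_some_iff] at hp ⊢
  obtain ⟨hf, i, hi, hic, hlt⟩ := hp
  refine ⟨hc.trans hf, i, hi, hic, fun j hj => (hlt j hj).trans_le (h _ fun he => ?_)⟩
  have := hlt j hj
  rw [he] at this
  exact this.not_ge hf

/-- An applicant who gets a raised college at `q` has a choice at `p`. If the cutoff of that choice
were not raised, she would keep it at `q`. -/
theorem exists_choice_eq_some_of_le {r : ROL C} {x p q : Fin C → ℝ} (hpq : p ≤ q)
    (h : ∃ c, p c < q c ∧ choice r x q = some c) : ∃ c, p c < q c ∧ choice r x p = some c := by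
  obtain ⟨c, hc, hq⟩ := h
  have hsome : (choice r x p).isSome := by
    obtain ⟨hf, i, hi, hic, -⟩ := choice_eq_some_iff.1 hq
    rw [choice, List.find?_isSome]
    exact ⟨c, hic ▸ List.getElem_mem hi, by simpa using (hpq c).trans hf⟩
  obtain ⟨d, hd⟩ := Option.isSome_iff_exists.1 hsome
  refine ⟨d, ?_, hd⟩
  by_contra hdq
  have hdc : choice r x q = some d :=
    choice_eq_some_of_le (not_lt.1 hdq) (fun e _ => hpq e) hd
  have : d = c := Option.some.inj (hdc.symm.trans hq)
  exact hdq (this ▸ hc)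

theorem choice_congr {r : ROL C} {x y p q : Fin C → ℝ} (h : ∀ c, p c ≤ x c ↔ q c ≤ y c) :
    choice r x p = choice r y q := by
  simp [choice, h]

theorem demand_eq {k : ℕ} (s : Fin k → Fin C → ℝ) (R : Fin k → ROL C) (p : Fin C → ℝ)
    (c : Fin C) : demand s R p c = (∑ j, if choice (R j) (s j) p = some c then (1 : ℝ) else 0) / k := by
  rw [demand, Finset.sum_boole]
  rfl

theorem grossSubstitutes_demand {k : ℕ} (s : Fin k → Fin C → ℝ) (R : Fin k → ROL C) :
    GrossSubstitutes (demand s R) := by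
  intro c p q _ _ hc h
  rw [demand, demand]
  refine div_le_div_of_nonneg_right (Nat.cast_le.2 (Finset.card_le_card ?_)) (Nat.cast_nonneg k)
  exact Finset.monotone_filter_right _ fun j _ hp => choice_eq_some_of_le hc h hp

variable {a b : ℝ}

theorem choice_truthfulROL {t : ApplicantType C a b} {c : Fin C} {p : Fin C → ℝ}
    (h0 : 0 < t.utility c) (h : ∀ d ≠ c, t.utility d < t.utility c) (hp : p c ≤ t.score c) :
    choice (truthfulROL t) t.score p = some c := by
  let r : Fin C → Fin C → Prop := fun c d => t.utility d ≤ t.utility c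
  have : Std.Total r := ⟨fun c d => le_total (t.utility d) (t.utility c)⟩
  have : IsTrans (Fin C) r := ⟨fun c d e h1 h2 => le_trans h2 h1⟩
  have hs := List.pairwise_insertionSort r
    ((List.finRange C).filter (fun c => 0 < t.utility c))
  have hmem : c ∈ (truthfulROL t).1 := by
    simp [truthfulROL, List.mem_insertionSort, h0]
  have hs' : (truthfulROL t).1.Pairwise r := hs
  rw [choice]
  revert hmem hs'
  generalize (truthfulROL t).1 = l
  intro hmem hs'
  cases l with
  | nil => simp at hmem
  | cons d l =>
    have hdc : d = c := by
      by_contra hne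
      rcases List.mem_cons.1 hmem with h1 | h1
      · exact hne h1.symm
      · exact absurd (List.rel_of_pairwise_cons hs' h1) (not_le.2 (h d hne))
    subst hdc
    simp [hp]

theorem measurable_utility (c : Fin C) :
    Measurable fun t : ApplicantType C a b => t.utility c := by
  unfold ApplicantType.utility; fun_prop

theorem measurable_score (c : Fin C) : Measurable fun t : ApplicantType C a b => t.score c := by
  unfold ApplicantType.score; fun_prop

theorem score_mem_Icc (t : ApplicantType C a b) (c : Fin C) : t.score c ∈ Set.Icc (0 : ℝ) 1 :=
  (t.2 c).2

/-- The type–list pairs that demand `c` at the cutoffs `p`. -/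
def choiceSet (a b : ℝ) (p : Fin C → ℝ) (c : Fin C) : Set (ApplicantType C a b × ROL C) :=
  {x | choice x.2 x.1.score p = some c}

/-- Scores matter only through the finitely many truth values `p c ≤ x c`, so the set is the
preimage of a subset of a discrete space. The same device, with comparisons of utilities, serves for
`measurable_truthfulROL`. -/
theorem measurableSet_choiceSet (p : Fin C → ℝ) (c : Fin C) :
    MeasurableSet (choiceSet a b p c) := by
  classical
  have h1 : Measurable fun x : ApplicantType C a b × ROL C =>
      ((fun c => p c ≤ x.1.score c : Fin C → Prop), x.2) := by
    refine Measurable.prodMk (measurable_pi_lambda _ fun c => ?_) measurable_snd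
    refine measurable_to_prop ?_
    have : MeasurableSet {x : ApplicantType C a b × ROL C | p c ≤ x.1.score c} :=
      measurableSet_le measurable_const ((measurable_score c).comp measurable_fst)
    convert this using 1
    ext x; simp
  have h2 : MeasurableSet {y : (Fin C → Prop) × ROL C |
      y.2.1.find? (fun c => decide (y.1 c)) = some c} := MeasurableSet.of_discrete
  convert h1 h2 using 1
  ext x
  simp only [choiceSet, choice, Set.mem_preimage, Set.mem_ofPred_eq]

theorem measurable_truthfulROL : Measurable (truthfulROL : ApplicantType C a b → ROL C) := by
  classical
  let F : (Fin C → Fin C → Prop) × (Fin C → Prop) → ROL C := fun y =>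
    ⟨((List.finRange C).filter (fun c => decide (y.2 c))).insertionSort y.1,
      (List.perm_insertionSort _ _).nodup_iff.mpr ((List.nodup_finRange C).filter _)⟩
  have h1 : Measurable fun t : ApplicantType C a b =>
      ((fun c d => t.utility d ≤ t.utility c : Fin C → Fin C → Prop),
        (fun c => 0 < t.utility c : Fin C → Prop)) := by
    refine Measurable.prodMk (measurable_pi_lambda _ fun c => measurable_pi_lambda _ fun d => ?_)
      (measurable_pi_lambda _ fun c => ?_) <;> refine measurable_to_prop ?_
    · have : MeasurableSet {t : ApplicantType C a b | t.utility d ≤ t.utility c} :=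
        measurableSet_le (measurable_utility d) (measurable_utility c)
      convert this using 1
      ext x; simp
    · have : MeasurableSet {t : ApplicantType C a b | 0 < t.utility c} :=
        measurableSet_lt measurable_const (measurable_utility c)
      convert this using 1
      ext x; simp
  have h2 : Measurable F := Measurable.of_discrete
  convert h2.comp h1 using 1
  funext t
  simp only [truthfulROL, F, Function.comp]
  congr

end Choice

/-! ### Mean demand: equicontinuity, compactness and strict monotonicity -/

section MeanDemand

variable {C : ℕ} {a b : ℝ} {η : Measure (ApplicantType C a b)}
  {σ : ℕ → Kernel (ApplicantType C a b) (ROL C)} {γ : ℝ}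

/-- Score hyperplanes are Lebesgue-null. Absolute continuity enters the proof only through this
fact. -/
theorem HasDensity.measure_score_eq (hη : HasDensity η) (c : Fin C) (x : ℝ) :
    η {t | t.score c = x} = 0 := by
  have hm : Measurable fun t : ApplicantType C a b => (t.utility, t.score) :=
    Measurable.prodMk (measurable_pi_lambda _ measurable_utility)
      (measurable_pi_lambda _ measurable_score)
  have h0 : (volume : Measure ((Fin C → ℝ) × (Fin C → ℝ))) (Set.univ ×ˢ {s | s c = x}) = 0 := by
    rw [Measure.volume_eq_prod, Measure.prod_prod]
    have : (volume : Measure (Fin C → ℝ)) {s | s c = x} = 0 := by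
      rw [volume_pi]
      exact Measure.pi_hyperplane (α := fun _ : Fin C => ℝ) (fun _ => volume) c x
    rw [this, mul_zero]
  have hms : MeasurableSet ((Set.univ : Set (Fin C → ℝ)) ×ˢ {s : Fin C → ℝ | s c = x}) :=
    MeasurableSet.univ.prod (measurableSet_eq_fun (measurable_pi_apply c) measurable_const)
  have := hη h0
  rw [Measure.map_apply hm hms] at this
  convert this using 2
  ext t; simp

/-- Uniformly in the strategy, the expected demand of an applicant is continuous in the cutoffs. -/
theorem HasDensity.exists_abs_choiceSet_sub_le [IsProbabilityMeasure η] (hη : HasDensity η)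
    (p : Fin C → ℝ) {ε : ℝ} (hε : 0 < ε) :
    ∃ δ > 0, ∀ q, dist q p < δ → ∀ (κ : Kernel (ApplicantType C a b) (ROL C)) [IsMarkovKernel κ] c,
      |(η ⊗ₘ κ).real (choiceSet a b q c) - (η ⊗ₘ κ).real (choiceSet a b p c)| ≤ ε := by
  have hlim : ∀ c, Tendsto (fun δ : ℝ => (η.map fun t => t.score c) (Metric.cthickening δ {p c}))
      (𝓝 0) (𝓝 0) := by
    intro c
    have : IsProbabilityMeasure (η.map fun t => t.score c) :=
      Measure.isProbabilityMeasure_map (measurable_score c).aemeasurable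
    have := tendsto_measure_cthickening_of_isCompact (μ := η.map fun t => t.score c)
      (isCompact_singleton (x := p c))
    rwa [Measure.map_apply (measurable_score c) (measurableSet_singleton _),
      show (fun t : ApplicantType C a b => t.score c) ⁻¹' {p c} = {t | t.score c = p c} from rfl,
      hη.measure_score_eq] at this
  have hsum := tendsto_finsetSum Finset.univ (fun c _ => hlim c)
  rw [Finset.sum_const_zero] at hsum
  have hev := hsum.eventually (gt_mem_nhds (ENNReal.ofReal_pos.2 hε))
  obtain ⟨δ, hδ, hδ'⟩ := Metric.eventually_nhds_iff.1 hev
  refine ⟨δ / 2, by positivity, fun q hq κ _ c => ?_⟩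
  have hW := hδ' (y := δ / 2) (by rw [Real.dist_eq, sub_zero, abs_of_pos] <;> linarith)
  -- `W` consists of the types with some score within `δ / 2` of its cutoff. Off `W` the same
  -- colleges are feasible at `p` and `q`, so under any strategy demand changes by at most `η W`.
  set W : Set (ApplicantType C a b) :=
    ⋃ d, (fun t => t.score d) ⁻¹' Metric.cthickening (δ / 2) {p d} with hWdef
  have hWm : MeasurableSet W := MeasurableSet.iUnion fun d =>
    measurable_score d Metric.isClosed_cthickening.measurableSet
  have hηW : η W ≤ ENNReal.ofReal ε := by
    refine (measure_iUnion_le _).trans ?_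
    rw [tsum_fintype]
    refine le_trans (le_of_eq ?_) hW.le
    refine Finset.sum_congr rfl fun d _ => ?_
    rw [Measure.map_apply (measurable_score d) Metric.isClosed_cthickening.measurableSet]
  have hmeas : (η ⊗ₘ κ).real (W ×ˢ Set.univ) ≤ ε := by
    refine ENNReal.toReal_le_of_le_ofReal hε.le ?_
    rw [Measure.compProd_apply_prod hWm MeasurableSet.univ]
    simpa using hηW
  have key : ∀ x ∉ W ×ˢ (Set.univ : Set (ROL C)), choice x.2 x.1.score q = choice x.2 x.1.score p := by
    intro x hx
    refine choice_congr fun d => ?_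
    have hx' : ∀ d, δ / 2 < |x.1.score d - p d| := by
      intro d
      have : x.1 ∉ W := fun h => hx ⟨h, trivial⟩
      simp only [hWdef, Set.mem_iUnion, not_exists, Set.mem_preimage,
        Metric.cthickening_singleton _ (half_pos hδ).le, Metric.mem_closedBall, not_le] at this
      exact this d
    have hqd : |q d - p d| < δ / 2 := (dist_le_pi_dist q p d).trans_lt hq
    have := hx' d
    rw [abs_lt] at hqd
    rcases lt_abs.1 this with h | h <;> constructor <;> intro h' <;> linarith [hqd.1, hqd.2]
  have hsub : ∀ q p : Fin C → ℝ,
      (∀ x ∉ W ×ˢ (Set.univ : Set (ROL C)), choice x.2 x.1.score q = choice x.2 x.1.score p) →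
      (η ⊗ₘ κ).real (choiceSet a b q c) ≤ (η ⊗ₘ κ).real (choiceSet a b p c) + ε := by
    intro q p h
    calc (η ⊗ₘ κ).real (choiceSet a b q c)
        ≤ (η ⊗ₘ κ).real (choiceSet a b p c ∪ W ×ˢ Set.univ) := by
          refine measureReal_mono fun x hx => ?_
          by_cases hxW : x ∈ W ×ˢ (Set.univ : Set (ROL C))
          · exact Or.inr hxW
          · exact Or.inl ((h x hxW).symm.trans hx)
      _ ≤ _ := (measureReal_union_le _ _).trans (by gcongr)
  rw [abs_le]
  constructor
  · linarith [hsub p q fun x hx => (key x hx).symm]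
  · linarith [hsub q p key]

/-- The expected per capita demand in the economy with `k` applicants. -/
noncomputable def meanDemand (η : Measure (ApplicantType C a b))
    (σ : ℕ → Kernel (ApplicantType C a b) (ROL C))
    (k : ℕ) (p : Fin C → ℝ) (c : Fin C) : ℝ :=
  (∑ j : Fin k, (η ⊗ₘ σ j).real (choiceSet a b p c)) / k

theorem meanDemand_mem_Icc [IsProbabilityMeasure η] [∀ i, IsMarkovKernel (σ i)] (k : ℕ)
    (p : Fin C → ℝ) (c : Fin C) : meanDemand η σ k p c ∈ Set.Icc (0 : ℝ) 1 := by
  refine ⟨by unfold meanDemand; positivity, div_le_one_of_le₀ ?_ (by positivity)⟩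
  refine (Finset.sum_le_card_nsmul _ _ 1 fun j _ => measureReal_le_one).trans ?_
  simp

/-- The `δ` for one applicant does not depend on her strategy, so it survives averaging and serves
all `k`. -/
theorem exists_dist_meanDemand_le [IsProbabilityMeasure η] [∀ i, IsMarkovKernel (σ i)]
    (hη : HasDensity η) (p : Fin C → ℝ) {ε : ℝ} (hε : 0 < ε) :
    ∃ δ > 0, ∀ q, dist q p < δ → ∀ k, dist (meanDemand η σ k q) (meanDemand η σ k p) ≤ ε := by
  obtain ⟨δ, hδ, h⟩ := hη.exists_abs_choiceSet_sub_le p hε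
  refine ⟨δ, hδ, fun q hq k => (dist_pi_le_iff hε.le).2 fun c => ?_⟩
  rw [Real.dist_eq, meanDemand, meanDemand, ← sub_div, ← Finset.sum_sub_distrib, abs_div,
    Nat.abs_cast]
  refine div_le_of_le_mul₀ (by positivity) hε.le ?_
  refine (Finset.abs_sum_le_sum_abs _ _).trans ?_
  refine (Finset.sum_le_card_nsmul Finset.univ _ ε fun (j : Fin k) _ => h q hq (σ j) c).trans ?_
  simp [mul_comm]

theorem continuous_meanDemand [IsProbabilityMeasure η] [∀ i, IsMarkovKernel (σ i)]
    (hη : HasDensity η) (k : ℕ) : Continuous (meanDemand η σ k) := by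
  refine continuous_iff_continuousAt.2 fun p => Metric.continuousAt_iff.2 fun ε hε => ?_
  obtain ⟨δ, hδ, h⟩ := exists_dist_meanDemand_le (σ := σ) hη p (half_pos hε)
  exact ⟨δ, hδ, fun q hq => (h q hq k).trans_lt (half_lt_self hε)⟩

/-- By the Arzelà–Ascoli theorem, the expected demands converge uniformly along a subsequence. -/
theorem exists_subseq_tendstoUniformlyOn_meanDemand [IsProbabilityMeasure η]
    [∀ i, IsMarkovKernel (σ i)] (hη : HasDensity η) :
    ∃ κ : ℕ → ℕ, StrictMono κ ∧ ∃ D : (Fin C → ℝ) → Fin C → ℝ,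
      TendstoUniformlyOn (fun l => meanDemand η σ (κ l)) D atTop (Set.Icc 0 1) := by
  let K := Set.Icc (0 : Fin C → ℝ) 1
  let F : ℕ → BoundedContinuousFunction K (Fin C → ℝ) := fun k =>
    BoundedContinuousFunction.mkOfCompact
      ⟨fun p => meanDemand η σ k p, (continuous_meanDemand hη k).comp continuous_subtype_val⟩
  have hcomp : IsCompact (closure (Set.range F)) := by
    refine BoundedContinuousFunction.arzela_ascoli (Set.Icc 0 1) isCompact_Icc _ ?_ ?_
    · rintro _ p ⟨k, rfl⟩
      exact ⟨fun c => (meanDemand_mem_Icc k _ c).1, fun c => (meanDemand_mem_Icc k _ c).2⟩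
    · intro p
      refine Metric.equicontinuousAt_iff.2 fun ε hε => ?_
      obtain ⟨δ, hδ, h⟩ := exists_dist_meanDemand_le (σ := σ) hη p (half_pos hε)
      refine ⟨δ, hδ, ?_⟩
      rintro q hq ⟨_, k, rfl⟩
      rw [dist_comm]
      exact (h q hq k).trans_lt (half_lt_self hε)
  obtain ⟨f, -, κ, hκ, hlim⟩ := hcomp.tendsto_subseq (x := F)
    (fun k => subset_closure ⟨k, rfl⟩)
  classical
  -- The values off the cube are irrelevant: the adjustment process never leaves it.
  refine ⟨κ, hκ, fun p => if h : p ∈ K then f ⟨p, h⟩ else 0, ?_⟩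
  rw [BoundedContinuousFunction.tendsto_iff_tendstoUniformly] at hlim
  rw [tendstoUniformlyOn_iff_tendstoUniformly_comp_coe]
  have hf : (fun p => if h : p ∈ K then f ⟨p, h⟩ else 0) ∘ ((↑) : K → Fin C → ℝ) = f :=
    funext fun p => dif_pos p.2
  rw [hf]
  exact hlim

/-- Raising a nonempty set of cutoffs lowers the aggregate demand for the colleges concerned by an
amount that is bounded below uniformly over the regular strategies. -/
theorem exists_pos_sum_choiceSet_add_le [IsProbabilityMeasure η] [∀ i, IsMarkovKernel (σ i)]
    (hab : a < b) (hb : 0 < b) (hfull : FullSupport η) (hσ : IsRegularProfile γ σ)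
    {p q : Fin C → ℝ} (hp : p ∈ Set.Icc (0 : Fin C → ℝ) 1) (hq : q ∈ Set.Icc (0 : Fin C → ℝ) 1)
    (hpq : p ≤ q) (hne : p ≠ q) :
    ∃ ε > 0, ∀ i, ∑ c with p c < q c, (η ⊗ₘ σ i).real (choiceSet a b q c) + ε ≤
      ∑ c with p c < q c, (η ⊗ₘ σ i).real (choiceSet a b p c) := by
  obtain ⟨c, hc⟩ : ∃ c, p c < q c := by
    by_contra! h
    exact hne (le_antisymm hpq h)
  -- Reporting truthfully, a type in `U` chooses `c` at `p`, but at `q` no raised college is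
  -- feasible for her.
  let U : Set (ApplicantType C a b) := {t | 0 < t.utility c ∧ (∀ d, d ≠ c → t.utility d < t.utility c)
    ∧ p c < t.score c ∧ ∀ d, p d < q d → t.score d < q d}
  have hcu : ∀ d, Continuous fun t : ApplicantType C a b => t.utility d := fun d => by
    unfold ApplicantType.utility; fun_prop
  have hcs : ∀ d, Continuous fun t : ApplicantType C a b => t.score d := fun d => by
    unfold ApplicantType.score; fun_prop
  have hU : IsOpen U := by
    have hUeq : U = {t | 0 < t.utility c} ∩ ((⋂ d, ⋂ (_ : d ≠ c), {t | t.utility d < t.utility c}) ∩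
        ({t | p c < t.score c} ∩ ⋂ d, ⋂ (_ : p d < q d), {t | t.score d < q d})) := by
      ext t; simp [U]
    rw [hUeq]
    exact (isOpen_lt continuous_const (hcu c)).inter ((isOpen_iInter_of_finite fun d =>
      isOpen_iInter_of_finite fun _ => isOpen_lt (hcu d) (hcu c)).inter
      ((isOpen_lt continuous_const (hcs c)).inter (isOpen_iInter_of_finite fun d =>
      isOpen_iInter_of_finite fun _ => isOpen_lt (hcs d) continuous_const)))
  have hηU : 0 < η U := by
    have hmax : max a 0 < b := max_lt hab hb
    refine hfull U hU ⟨(fun d => if d = c then ⟨b, hab.le, le_rfl⟩ else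
      ⟨max a 0, le_max_left _ _, hmax.le⟩, fun d => if d = c then ⟨(p c + q c) / 2, ?_, ?_⟩ else
      ⟨0, by simp⟩), ⟨?_, ?_, ?_, ?_⟩, ?_⟩
    · linarith [hp.1 c, hq.1 c, show (0 : Fin C → ℝ) c = 0 from rfl]
    · linarith [hp.2 c, hq.2 c, show (1 : Fin C → ℝ) c = 1 from rfl]
    · simpa [ApplicantType.utility] using hb
    · intro d hd
      simpa [ApplicantType.utility, hd] using max_lt_iff.1 hmax
    · simp only [ApplicantType.score, if_true]
      linarith
    · intro d hd
      by_cases h : d = c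
      · subst h
        simp only [ApplicantType.score, if_true]
        linarith
      · simpa [ApplicantType.score, h] using (hp.1 d).trans_lt hd
    · intro d
      by_cases h : d = c
      · simpa [ApplicantType.utility, h] using max_lt_iff.1 hmax |>.imp le_of_lt le_of_lt
      · simp [ApplicantType.utility, h]
  -- Each type in `U` is truthful with probability at least `γ`, so this loss is common to all
  -- applicants.
  refine ⟨γ * η.real U, mul_pos hσ.1 (ENNReal.toReal_pos hηU.ne' (measure_ne_top _ _)), fun i => ?_⟩
  have hsum : ∀ p' : Fin C → ℝ, ∑ d with p d < q d, (η ⊗ₘ σ i).real (choiceSet a b p' d)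
      = (η ⊗ₘ σ i).real (⋃ d ∈ Finset.univ.filter (fun d => p d < q d), choiceSet a b p' d) := by
    intro p'
    rw [measureReal_biUnion_finset]
    · intro d _ e _ hde
      exact Set.disjoint_left.2 fun x hx hx' => hde (Option.some.inj (hx.symm.trans hx'))
    · exact fun d _ => measurableSet_choiceSet p' d
  rw [hsum, hsum]
  set A := fun p' : Fin C → ℝ =>
    ⋃ d ∈ Finset.univ.filter (fun d => p d < q d), choiceSet a b p' d with hA
  have hAm : ∀ p', MeasurableSet (A p') := fun p' =>
    Finset.measurableSet_biUnion _ fun d _ => measurableSet_choiceSet p' d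
  have hmemA : ∀ p' x, x ∈ A p' ↔ ∃ d, p d < q d ∧ choice x.2 x.1.score p' = some d := by
    intro p' x; simp [hA, choiceSet]
  have hsub : A q ⊆ A p := fun x hx =>
    (hmemA _ _).2 (exists_choice_eq_some_of_le hpq ((hmemA _ _).1 hx))
  have hdiff := measureReal_sdiff (μ := η ⊗ₘ σ i) hsub (hAm q)
    (measure_ne_top _ _)
  have hlow : γ * η.real U ≤ (η ⊗ₘ σ i).real (A p \ A q) := by
    rw [measureReal_def, measureReal_def, ← ENNReal.toReal_ofReal hσ.1.le, ← ENNReal.toReal_mul]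
    refine ENNReal.toReal_mono (measure_ne_top _ _) ?_
    rw [Measure.compProd_apply ((hAm p).diff (hAm q)), ← setLIntegral_const]
    refine (setLIntegral_mono' hU.measurableSet fun t ht => ?_).trans (setLIntegral_le_lintegral U _)
    have h1 : ENNReal.ofReal γ ≤ σ i t {truthfulROL t} :=
      (ENNReal.ofReal_le_iff_le_toReal (measure_ne_top _ _)).2 (hσ.2 i t)
    refine h1.trans (measure_mono ?_)
    rintro _ rfl
    obtain ⟨ht0, ht1, ht2, ht3⟩ := ht
    refine ⟨(hmemA _ _).2 ⟨c, hc, choice_truthfulROL ht0 ht1 ht2.le⟩, fun hx => ?_⟩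
    obtain ⟨d, hd, hd'⟩ := (hmemA _ _).1 hx
    exact (choice_eq_some_iff.1 hd').1.not_gt (ht3 d hd)
  linarith

/-- The limits of the expected demands under a regular profile are demand systems. -/
theorem isDemandSystem_of_tendstoUniformlyOn [IsProbabilityMeasure η] [∀ i, IsMarkovKernel (σ i)]
    (hab : a < b) (hb : 0 < b) (hη : HasDensity η) (hfull : FullSupport η)
    (hσ : IsRegularProfile γ σ) {κ : ℕ → ℕ} (hκ : Tendsto κ atTop atTop)
    {D : (Fin C → ℝ) → Fin C → ℝ}
    (hD : TendstoUniformlyOn (fun l => meanDemand η σ (κ l)) D atTop (Set.Icc 0 1)) :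
    IsDemandSystem D := by
  have hpt : ∀ p ∈ Set.Icc (0 : Fin C → ℝ) 1, ∀ c,
      Tendsto (fun l => meanDemand η σ (κ l) p c) atTop (𝓝 (D p c)) := fun p hp =>
    tendsto_pi_nhds.1 (hD.tendsto_at hp)
  refine ⟨hD.continuousOn (Frequently.of_forall fun l => (continuous_meanDemand hη _).continuousOn),
    ?_, ?_, ?_⟩
  · intro c p q hp hq hc h
    refine le_of_tendsto_of_tendsto' (hpt p hp c) (hpt q hq c) fun l => ?_
    unfold meanDemand
    gcongr
    · exact measure_ne_top _ _
    · exact fun x hx => choice_eq_some_of_le hc h hx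
  · intro c p hp hpc
    refine tendsto_nhds_unique (hpt p hp c) (tendsto_const_nhds.congr fun l => ?_)
    symm
    rw [meanDemand, Finset.sum_eq_zero, zero_div]
    intro j _
    have hms : MeasurableSet {t : ApplicantType C a b | t.score c = 1} :=
      measurableSet_eq_fun (measurable_score c) measurable_const
    have h0 : (η ⊗ₘ σ j) ({t | t.score c = 1} ×ˢ Set.univ) = 0 := by
      rw [Measure.compProd_apply_prod hms MeasurableSet.univ]
      simpa using hη.measure_score_eq c 1
    rw [measureReal_def, measure_mono_null (fun x hx => ?_) h0, ENNReal.toReal_zero]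
    refine ⟨le_antisymm (score_mem_Icc x.1 c).2 ?_, trivial⟩
    rw [← hpc]
    exact (choice_eq_some_iff.1 hx).1
  -- A strict inequality alone would be lost in the limit; the gap `ε`, common to all applicants,
  -- survives averaging.
  · intro p hp q hq hpq hne
    obtain ⟨ε, hε, h⟩ := exists_pos_sum_choiceSet_add_le hab hb hfull hσ hp hq hpq hne
    refine lt_of_lt_of_le (lt_add_of_pos_right _ hε) ?_
    refine le_of_tendsto_of_tendsto
      ((tendsto_finsetSum _ fun c _ => hpt q hq c).add_const ε)
      (tendsto_finsetSum _ fun c _ => hpt p hp c) ?_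
    filter_upwards [hκ.eventually_ge_atTop 1] with l hl
    have hk : (0 : ℝ) < κ l := by exact_mod_cast hl
    simp only [meanDemand]
    rw [← Finset.sum_div, ← Finset.sum_div, Finset.sum_comm,
      Finset.sum_comm (s := Finset.univ.filter fun c => p c < q c),
      div_add' _ _ _ hk.ne']
    gcongr
    calc _ = ∑ j : Fin (κ l), (∑ c with p c < q c, (η ⊗ₘ σ j).real (choiceSet a b q c) + ε) := by
          rw [Finset.sum_add_distrib]; simp [mul_comm]
      _ ≤ _ := Finset.sum_le_sum fun j _ => h j

end MeanDemand

/-! ### A strong law for row-wise independent arrays -/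

section LawOfLargeNumbers

variable {Ω : Type*} [MeasurableSpace Ω] {μ : Measure Ω} [IsProbabilityMeasure μ]

/-- Centred variables with values in `[0, 1]` are sub-Gaussian with parameter `1 / 4`, so the row
sum reaches `k * ε` with probability at most `exp (-2 * ε ^ 2) ^ k`. This is summable, and the first
Borel–Cantelli lemma needs no independence between rows. -/
theorem ae_eventually_sum_sub_integral_div_lt {X : (k : ℕ) → Fin k → Ω → ℝ}
    (hm : ∀ k j, Measurable (X k j)) (hX : ∀ k j ω, X k j ω ∈ Set.Icc (0 : ℝ) 1)
    (hindep : ∀ k, iIndepFun (X k) μ) {ε : ℝ} (hε : 0 < ε) :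
    ∀ᵐ ω ∂μ, ∀ᶠ k : ℕ in atTop, (∑ j, (X k j ω - ∫ ω, X k j ω ∂μ)) / k < ε := by
  let s : ℕ → Set Ω := fun k => {ω | k * ε ≤ ∑ j, (X k j ω - ∫ ω, X k j ω ∂μ)}
  have hbound : ∀ k : ℕ, μ (s k) ≤ ENNReal.ofReal (Real.exp (-(2 * ε ^ 2)) ^ k) := by
    intro k
    refine (ENNReal.le_ofReal_iff_toReal_le (measure_ne_top _ _) (by positivity)).2 ?_
    have hi : iIndepFun (fun (j : Fin k) ω => X k j ω - ∫ ω, X k j ω ∂μ) μ :=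
      (hindep k).comp (fun j x => x - ∫ ω, X k j ω ∂μ) fun j => by fun_prop
    have := HasSubgaussianMGF.measure_sum_ge_le_of_iIndepFun hi (s := Finset.univ)
      (fun j _ => hasSubgaussianMGF_of_mem_Icc (hm k j).aemeasurable
        (Eventually.of_forall (hX k j))) (ε := k * ε) (by positivity)
    refine this.trans (le_of_eq ?_)
    rw [← Real.exp_nat_mul]
    congr 1
    rcases Nat.eq_zero_or_pos k with rfl | hk
    · simp
    · have : (k : ℝ) ≠ 0 := by positivity
      simp
      field_simp
  have hsum : ∑' k, μ (s k) ≠ ⊤ := by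
    refine ne_top_of_le_ne_top ?_ (ENNReal.tsum_le_tsum hbound)
    have hr : Real.exp (-(2 * ε ^ 2)) < 1 := Real.exp_lt_one_iff.2 (by nlinarith [sq_pos_of_pos hε])
    exact (summable_geometric_of_lt_one (Real.exp_pos _).le hr).tsum_ofReal_ne_top
  filter_upwards [ae_eventually_notMem hsum] with ω hω
  filter_upwards [hω, eventually_gt_atTop 0] with k hk hk0
  rw [div_lt_iff₀ (by exact_mod_cast hk0), mul_comm]
  exact not_le.1 hk

/-- A strong law of large numbers for the rows of a triangular array with values in `[0, 1]`,
without any assumption on the dependence between the rows. -/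
theorem ae_tendsto_sum_sub_integral_div {X : (k : ℕ) → Fin k → Ω → ℝ}
    (hm : ∀ k j, Measurable (X k j)) (hX : ∀ k j ω, X k j ω ∈ Set.Icc (0 : ℝ) 1)
    (hindep : ∀ k, iIndepFun (X k) μ) :
    ∀ᵐ ω ∂μ, Tendsto (fun k : ℕ => (∑ j, (X k j ω - ∫ ω, X k j ω ∂μ)) / k) atTop (𝓝 0) := by
  have h1 := ae_all_iff.2 fun n : ℕ =>
    ae_eventually_sum_sub_integral_div_lt hm hX hindep (Nat.one_div_pos_of_nat (α := ℝ) (n := n))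
  -- The lower tail of `X` is the upper tail of `1 - X`.
  have h2 := ae_all_iff.2 fun n : ℕ =>
    ae_eventually_sum_sub_integral_div_lt (X := fun k j ω => 1 - X k j ω) (μ := μ)
      (fun k j => (hm k j).const_sub 1)
      (fun k j ω => ⟨by linarith [(hX k j ω).2], by linarith [(hX k j ω).1]⟩)
      (fun k => (hindep k).comp (fun j x => 1 - x) fun j => by fun_prop)
      (Nat.one_div_pos_of_nat (α := ℝ) (n := n))
  filter_upwards [h1, h2] with ω h1 h2
  refine Metric.tendsto_nhds.2 fun ε hε => ?_
  obtain ⟨n, hn⟩ := exists_nat_one_div_lt hε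
  filter_upwards [h1 n, h2 n] with k hk1 hk2
  have hint : ∀ j : Fin k, Integrable (X k j) μ := fun j =>
    Integrable.of_mem_Icc 0 1 (hm k j).aemeasurable (Eventually.of_forall (hX k j))
  have he : ∑ j : Fin k, (1 - X k j ω - ∫ ω, (1 - X k j ω) ∂μ)
      = -∑ j : Fin k, (X k j ω - ∫ ω, X k j ω ∂μ) := by
    rw [← Finset.sum_neg_distrib]
    refine Finset.sum_congr rfl fun j _ => ?_
    rw [integral_sub (integrable_const _) (hint j)]
    simp
  rw [he, neg_div] at hk2
  rw [Real.dist_eq, sub_zero, abs_lt]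
  constructor <;> linarith

end LawOfLargeNumbers

/-! ### Rounded capacities per applicant -/

section Capacity

variable {C : ℕ} {S : Fin C → ℝ}

theorem eventually_capacity_pos (hS : ∀ c, 0 < S c) : ∀ᶠ k in atTop, ∀ c, 0 < capacity S k c := by
  refine eventually_all.2 fun c => ?_
  have : Tendsto (fun k : ℕ => (k : ℝ) * S c) atTop atTop :=
    tendsto_natCast_atTop_atTop.atTop_mul_const (hS c)
  filter_upwards [this.eventually_gt_atTop (1 / 2)] with k hk
  exact Nat.ceil_pos.2 (by linarith)

theorem tendsto_capacity_div (hS : ∀ c, 0 < S c) :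
    Tendsto (fun (k : ℕ) c => (capacity S k c : ℝ) / k) atTop (𝓝 S) := by
  refine tendsto_pi_nhds.2 fun c => ?_
  have h0 : Tendsto (fun k : ℕ => 1 / (k : ℝ)) atTop (𝓝 0) := tendsto_one_div_atTop_nhds_zero_nat
  refine tendsto_of_tendsto_of_tendsto_of_le_of_le' (g := fun k : ℕ => S c - 1 / (k : ℝ))
    (h := fun k : ℕ => S c + 1 / (k : ℝ)) ?_ ?_ ?_ ?_
  · simpa using h0.const_sub (S c)
  · simpa using h0.const_add (S c)
  · filter_upwards [eventually_gt_atTop 0] with k hk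
    have hk' : (0 : ℝ) < k := by exact_mod_cast hk
    rw [le_div_iff₀ hk', sub_mul, one_div, inv_mul_cancel₀ hk'.ne', capacity]
    linarith [Nat.le_ceil ((k : ℝ) * S c - 1 / 2)]
  -- A positive capacity ensures that the argument of the natural-number ceiling is not truncated at
  -- `0`.
  · filter_upwards [eventually_gt_atTop 0, eventually_capacity_pos hS] with k hk hpos
    have hk' : (0 : ℝ) < k := by exact_mod_cast hk
    rw [div_le_iff₀ hk', add_mul, one_div, inv_mul_cancel₀ hk'.ne', capacity]
    linarith [Nat.ceil_lt_add_one (Nat.ceil_pos.1 (hpos c)).le]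

end Capacity

/-! ### Convergence in the random economies, uniformly in the deviator -/

section RandomEconomies

variable {C : ℕ} {a b : ℝ} {η : Measure (ApplicantType C a b)}
  {σ : ℕ → Kernel (ApplicantType C a b) (ROL C)}

theorem abs_demand_deviate_sub_le {k : ℕ} (i : Option ℕ) (t : Fin k → ApplicantType C a b)
    (s : Fin k → Fin C → ℝ) (R : Fin k → ROL C) (p : Fin C → ℝ) (c : Fin C) :
    |demand s (deviate i t R) p c - demand s R p c| ≤ 1 / k := by
  rw [demand_eq, demand_eq, ← sub_div, ← Finset.sum_sub_distrib, abs_div, Nat.abs_cast]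
  gcongr
  refine (Finset.abs_sum_le_sum_abs _ _).trans ?_
  have h : ∀ j : Fin k, |(if choice (deviate i t R j) (s j) p = some c then (1 : ℝ) else 0)
      - (if choice (R j) (s j) p = some c then (1 : ℝ) else 0)|
      ≤ if i = some (j : ℕ) then 1 else 0 := by
    intro j
    by_cases hi : i = some (j : ℕ)
    · rw [if_pos hi]
      split_ifs <;> simp
    · simp [deviate, hi]
  refine (Finset.sum_le_sum fun j _ => h j).trans ?_
  rw [Finset.sum_boole]
  norm_cast
  refine Finset.card_le_one.2 fun x hx y hy => ?_
  simp only [Finset.mem_filter, Finset.mem_univ, true_and] at hx hy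
  exact Fin.ext (Option.some.inj (hx.symm.trans hy))

variable {Ω : Type*} {T : (k : ℕ) → Fin k → Ω → ApplicantType C a b}
  {R : (k : ℕ) → Fin k → Ω → ROL C}

theorem randomCutoff_mem_Icc (S : Fin C → ℝ) (k : ℕ) (i : Option ℕ) (ω : Ω) :
    randomCutoff S T R k i ω ∈ Set.Icc (0 : Fin C → ℝ) 1 :=
  daCutoff_mem_Icc _ _ _ fun _ c => score_mem_Icc _ c

theorem isMarketClearing_randomCutoff {S : Fin C → ℝ} {k : ℕ} (i : Option ℕ) {ω : Ω}
    (hinj : ∀ c, Function.Injective fun j => (T k j ω).score c)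
    (hpos : ∀ c, 0 < capacity S k c) :
    IsMarketClearing (demand (fun j => (T k j ω).score)
      (deviate i (fun j => T k j ω) (fun j => R k j ω)))
      (fun c => (capacity S k c : ℝ) / k) (randomCutoff S T R k i ω) := fun c =>
  have hs : ∀ (j : Fin k) c, 0 ≤ (T k j ω).score c := fun _ c => (score_mem_Icc _ c).1
  ⟨demand_daCutoff_le _ _ _ hs hinj hpos c, demand_daCutoff_eq _ _ _ hs hinj hpos c⟩

/-- The filter `atTop ×ˢ ⊤` on pairs of economy and deviator encodes convergence uniform in the
deviator, which the `1 / k` bound provides. -/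
theorem tendsto_demand_deviate {κ : ℕ → ℕ} (hκ : Tendsto κ atTop atTop) {ω : Ω} {p : Fin C → ℝ}
    {c : Fin C} {d : ℝ}
    (h : Tendsto (fun l => demand (fun j => (T (κ l) j ω).score) (fun j => R (κ l) j ω) p c)
      atTop (𝓝 d)) :
    Tendsto (fun x : ℕ × Option ℕ => demand (fun j => (T (κ x.1) j ω).score)
      (deviate x.2 (fun j => T (κ x.1) j ω) (fun j => R (κ x.1) j ω)) p c)
      (atTop ×ˢ ⊤) (𝓝 d) := by
  have h1 : Tendsto (fun x : ℕ × Option ℕ => 1 / (κ x.1 : ℝ)) (atTop ×ˢ ⊤) (𝓝 0) :=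
    (tendsto_one_div_atTop_nhds_zero_nat.comp hκ).comp tendsto_fst
  have h2 := squeeze_zero_norm (fun x : ℕ × Option ℕ => (Real.norm_eq_abs _).trans_le
    (abs_demand_deviate_sub_le x.2 (fun j => T (κ x.1) j ω) (fun j => (T (κ x.1) j ω).score)
      (fun j => R (κ x.1) j ω) p c)) h1
  have h3 := h2.add (h.comp (tendsto_fst (g := (⊤ : Filter (Option ℕ)))))
  simpa only [Function.comp_def, sub_add_cancel, zero_add] using h3

variable [MeasurableSpace Ω] {μ : Measure Ω}

theorem measurable_ite_choice {t : Ω → ApplicantType C a b} {r : Ω → ROL C} (ht : Measurable t)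
    (hr : Measurable r) (p : Fin C → ℝ) (c : Fin C) :
    Measurable fun ω => if choice (r ω) (t ω).score p = some c then (1 : ℝ) else 0 :=
  Measurable.ite (ht.prodMk hr (measurableSet_choiceSet p c)) measurable_const measurable_const

theorem measurable_deviate (h : IsRealization μ η σ T R) (k : ℕ) (i : Option ℕ) (j : Fin k) :
    Measurable fun ω => deviate i (fun j => T k j ω) (fun j => R k j ω) j := by
  unfold deviate
  split_ifs
  · exact measurable_truthfulROL.comp (h.measurable_type k j)
  · exact h.measurable_list k j

theorem integral_ite_choice (h : IsRealization μ η σ T R) (k : ℕ) (j : Fin k) (p : Fin C → ℝ)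
    (c : Fin C) : ∫ ω, (if choice (R k j ω) (T k j ω).score p = some c then (1 : ℝ) else 0) ∂μ
      = (η ⊗ₘ σ j).real (choiceSet a b p c) := by
  have hm := (h.measurable_type k j).prodMk (h.measurable_list k j)
  rw [← h.law k j, measureReal_def, Measure.map_apply hm (measurableSet_choiceSet p c),
    ← measureReal_def, ← integral_indicator_one (hm (measurableSet_choiceSet p c))]
  refine integral_congr_ae (Eventually.of_forall fun ω => ?_)
  simp [Set.indicator_apply, choiceSet]

variable [IsProbabilityMeasure μ]

theorem integrable_ite_choice {t : Ω → ApplicantType C a b} {r : Ω → ROL C} (ht : Measurable t)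
    (hr : Measurable r) (p : Fin C → ℝ) (c : Fin C) :
    Integrable (fun ω => if choice (r ω) (t ω).score p = some c then (1 : ℝ) else 0) μ :=
  Integrable.of_mem_Icc 0 1 (measurable_ite_choice ht hr p c).aemeasurable
    (Eventually.of_forall fun ω => by split_ifs <;> simp)

theorem integrable_demand_deviate (h : IsRealization μ η σ T R) (k : ℕ) (i : Option ℕ)
    (p : Fin C → ℝ) (c : Fin C) :
    Integrable (fun ω => demand (fun j => (T k j ω).score)
      (deviate i (fun j => T k j ω) (fun j => R k j ω)) p c) μ := by
  simp only [demand_eq]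
  exact (integrable_finsetSum _ fun j _ =>
    integrable_ite_choice (h.measurable_type k j) (measurable_deviate h k i j) p c).div_const _

theorem expectedDemand_none (h : IsRealization μ η σ T R) (k : ℕ) (p : Fin C → ℝ) :
    expectedDemand μ T R k none p = meanDemand η σ k p := by
  funext c
  have hd : ∀ ω, deviate none (fun j => T k j ω) (fun j => R k j ω) = fun j => R k j ω :=
    fun ω => by funext j; simp [deviate]
  simp only [expectedDemand, meanDemand, hd, demand_eq]
  rw [integral_div, integral_finsetSum _ fun j _ =>
    integrable_ite_choice (h.measurable_type k j) (h.measurable_list k j) p c]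
  simp only [integral_ite_choice h]

theorem dist_expectedDemand_meanDemand_le (h : IsRealization μ η σ T R) (k : ℕ) (i : Option ℕ)
    (p : Fin C → ℝ) : dist (expectedDemand μ T R k i p) (meanDemand η σ k p) ≤ 1 / k := by
  rw [← expectedDemand_none h]
  refine (dist_pi_le_iff (by positivity)).2 fun c => ?_
  rw [Real.dist_eq, expectedDemand, expectedDemand,
    ← integral_sub (integrable_demand_deviate h k i p c) (integrable_demand_deviate h k none p c)]
  have hd : ∀ ω, deviate none (fun j => T k j ω) (fun j => R k j ω) = fun j => R k j ω :=
    fun ω => by funext j; simp [deviate]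
  simp only [hd]
  have hle := norm_integral_le_of_norm_le_const (μ := μ) (Eventually.of_forall fun ω =>
    (Real.norm_eq_abs _).trans_le (abs_demand_deviate_sub_le i (fun j => T k j ω)
      (fun j => (T k j ω).score) (fun j => R k j ω) p c))
  rwa [probReal_univ, mul_one, Real.norm_eq_abs] at hle

/-- The expected demands converge uniformly in the deviator and the cutoffs. -/
theorem tendstoUniformly_expectedDemand (h : IsRealization μ η σ T R) {κ : ℕ → ℕ}
    (hκ : Tendsto κ atTop atTop) {D : (Fin C → ℝ) → Fin C → ℝ}
    (hD : TendstoUniformlyOn (fun l => meanDemand η σ (κ l)) D atTop (Set.Icc 0 1)) :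
    TendstoUniformly (fun (l : ℕ) (x : Option ℕ × Set.Icc (0 : Fin C → ℝ) 1) =>
      expectedDemand μ T R (κ l) x.1 x.2) (fun x => D x.2) atTop := by
  refine Metric.tendstoUniformly_iff.2 fun ε hε => ?_
  have h0 : Tendsto (fun l => 1 / (κ l : ℝ)) atTop (𝓝 0) :=
    tendsto_one_div_atTop_nhds_zero_nat.comp hκ
  filter_upwards [Metric.tendstoUniformlyOn_iff.1 hD (ε / 2) (half_pos hε),
    h0.eventually (gt_mem_nhds (half_pos hε))] with l h1 h2 x
  have h3 := dist_expectedDemand_meanDemand_le h (κ l) x.1 x.2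
  have h4 := h1 x.2 x.2.2
  have h5 := dist_triangle_right (D x.2) (expectedDemand μ T R (κ l) x.1 x.2)
    (meanDemand η σ (κ l) x.2)
  linarith

theorem ae_tendsto_demand_sub_meanDemand (h : IsRealization μ η σ T R) (p : Fin C → ℝ)
    (c : Fin C) :
    ∀ᵐ ω ∂μ, Tendsto (fun k => demand (fun j => (T k j ω).score) (fun j => R k j ω) p c
      - meanDemand η σ k p c) atTop (𝓝 0) := by
  have := ae_tendsto_sum_sub_integral_div (μ := μ)
    (X := fun k j ω => if choice (R k j ω) (T k j ω).score p = some c then (1 : ℝ) else 0)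
    (fun k j => measurable_ite_choice (h.measurable_type k j) (h.measurable_list k j) p c)
    (fun k j ω => by split_ifs <;> simp)
    (fun k => (h.indep k).comp (fun j x => if choice x.2 x.1.score p = some c then (1 : ℝ) else 0)
      fun j => measurable_ite_choice measurable_fst measurable_snd p c)
  filter_upwards [this] with ω hω
  refine hω.congr fun k => ?_
  rw [demand_eq, meanDemand, ← sub_div, ← Finset.sum_sub_distrib]
  simp only [integral_ite_choice h]

/-- The scores of two applicants at a college are independent with atomless laws, so ties are null
by Fubini. -/
theorem ae_injective_score [IsProbabilityMeasure η] [∀ i, IsMarkovKernel (σ i)]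
    (hη : HasDensity η) (h : IsRealization μ η σ T R) :
    ∀ᵐ ω ∂μ, ∀ k c, Function.Injective fun j => (T k j ω).score c := by
  refine ae_all_iff.2 fun k => ae_all_iff.2 fun c => ?_
  have hne : ∀ i j : Fin k, i ≠ j → ∀ᵐ ω ∂μ, (T k i ω).score c ≠ (T k j ω).score c := by
    intro i j hij
    have hmi : ∀ i, Measurable fun ω => (T k i ω).score c := fun i =>
      (measurable_score c).comp (h.measurable_type k i)
    have hind : IndepFun (fun ω => (T k i ω).score c) (fun ω => (T k j ω).score c) μ :=
      ((h.indep k).indepFun hij).comp (φ := fun x : ApplicantType C a b × ROL C => x.1.score c)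
        (ψ := fun x : ApplicantType C a b × ROL C => x.1.score c)
        ((measurable_score c).comp measurable_fst) ((measurable_score c).comp measurable_fst)
    have hmap := (indepFun_iff_map_prod_eq_prod_map_map (hmi i).aemeasurable
      (hmi j).aemeasurable).1 hind
    have hT : μ.map (T k j) = η := by
      have h1 : (μ.map fun ω => (T k j ω, R k j ω)).map Prod.fst = μ.map (T k j) :=
        Measure.map_map measurable_fst ((h.measurable_type k j).prodMk (h.measurable_list k j))
      rw [← h1, h.law k j]
      exact Measure.fst_compProd η (σ j)
    have hdiag : MeasurableSet {x : ℝ × ℝ | x.1 = x.2} :=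
      measurableSet_eq_fun measurable_fst measurable_snd
    have hzero : (μ.map fun ω => ((T k i ω).score c, (T k j ω).score c)) {x | x.1 = x.2} = 0 := by
      rw [hmap, Measure.measure_prod_null hdiag]
      refine Eventually.of_forall fun x => ?_
      have : (μ.map fun ω => (T k j ω).score c) {x} = 0 := by
        rw [← Function.comp_def (fun t : ApplicantType C a b => t.score c) (T k j),
          ← Measure.map_map (measurable_score c) (h.measurable_type k j), hT,
          Measure.map_apply (measurable_score c) (measurableSet_singleton x)]
        exact hη.measure_score_eq c x
      refine measure_mono_null (fun y hy => ?_) this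
      exact (show x = y from hy).symm
    rw [Measure.map_apply ((hmi i).prodMk (hmi j)) hdiag] at hzero
    exact measure_eq_zero_iff_ae_notMem.1 hzero
  have hall : ∀ᵐ ω ∂μ, ∀ i j : Fin k, i ≠ j → (T k i ω).score c ≠ (T k j ω).score c :=
    ae_all_iff.2 fun i => ae_all_iff.2 fun j => by
      by_cases hij : i = j
      · simp [hij]
      · simpa [hij] using hne i j hij
  filter_upwards [hall] with ω hω i j hij
  by_contra hne
  exact hω i j hne hij

/-- The random cutoffs converge almost surely, uniformly in the deviator, to the market clearing
cutoffs of the limit of the expected demands. -/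
theorem ae_tendsto_randomCutoff [IsProbabilityMeasure η] [∀ i, IsMarkovKernel (σ i)]
    (hη : HasDensity η) (h : IsRealization μ η σ T R) {S : Fin C → ℝ} (hS : ∀ c, 0 < S c)
    {κ : ℕ → ℕ} (hκ : Tendsto κ atTop atTop) {D : (Fin C → ℝ) → Fin C → ℝ}
    (hdem : IsDemandSystem D)
    (hD : TendstoUniformlyOn (fun l => meanDemand η σ (κ l)) D atTop (Set.Icc 0 1))
    {p : Fin C → ℝ} (hp : p ∈ Set.Icc (0 : Fin C → ℝ) 1) (hmc : IsMarketClearing D S p) :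
    ∀ᵐ ω ∂μ, Tendsto (fun l : ℕ => ⨆ i : Option ℕ, ‖randomCutoff S T R (κ l) i ω - p‖)
      atTop (𝓝 0) := by
  have hlln := ae_all_iff.2 fun r : Fin C → ℚ => ae_all_iff.2 fun c =>
    ae_tendsto_demand_sub_meanDemand h (fun c => (r c : ℝ)) c
  filter_upwards [ae_injective_score hη h, hlln] with ω hinj hω
  have hκL : Tendsto (fun x : ℕ × Option ℕ => κ x.1) (atTop ×ˢ ⊤) atTop := hκ.comp tendsto_fst
  have hconv : Tendsto (fun x : ℕ × Option ℕ => randomCutoff S T R (κ x.1) x.2 ω) (atTop ×ˢ ⊤)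
      (𝓝 p) := by
    refine hmc.tendsto hdem hp (fun x => grossSubstitutes_demand _ _)
      (fun r hr => tendsto_pi_nhds.2 fun c => ?_) ((tendsto_capacity_div hS).comp hκL)
      (fun x => randomCutoff_mem_Icc S _ _ ω) ((hκL.eventually (eventually_capacity_pos hS)).mono
        fun x hx => isMarketClearing_randomCutoff x.2 (hinj _) hx)
    refine tendsto_demand_deviate hκ ?_
    have h1 := ((hω r c).comp hκ).add ((tendsto_pi_nhds.1 (hD.tendsto_at hr)) c)
    simpa only [Function.comp_def, sub_add_cancel, zero_add] using h1
  -- Convergence to a constant along `atTop ×ˢ ⊤` is uniform convergence in the second variable.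
  have hunif : TendstoUniformly (fun l i => randomCutoff S T R (κ l) i ω) (fun _ => p) atTop :=
    tendstoUniformly_iff_tendsto.2
      ((tendsto_const_nhds.prodMk_nhds hconv).mono_right (nhds_le_uniformity p))
  refine Metric.tendsto_nhds.2 fun ε hε => ?_
  filter_upwards [Metric.tendstoUniformly_iff.1 hunif (ε / 2) (half_pos hε)] with l hl
  have hle : ⨆ i : Option ℕ, ‖randomCutoff S T R (κ l) i ω - p‖ ≤ ε / 2 :=
    ciSup_le fun i => by rw [← dist_eq_norm, dist_comm]; exact (hl i).le
  rw [Real.dist_eq, sub_zero, abs_of_nonneg (Real.iSup_nonneg fun i => norm_nonneg _)]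
  linarith

end RandomEconomies

/-! ### The main theorem -/

theorem proposition1 {C : ℕ} (hC : 2 ≤ C) {a b : ℝ} (hab : a < b) (hb : 0 < b)
    (S : Fin C → ℝ) (hS : ∀ c, 0 < S c ∧ S c < 1)
    (η : Measure (ApplicantType C a b)) [IsProbabilityMeasure η]
    (hη : HasDensity η) (hfull : FullSupport η)
    (γ : ℝ) (σ : ℕ → Kernel (ApplicantType C a b) (ROL C)) [∀ i, IsMarkovKernel (σ i)]
    (hσ : IsRegularProfile γ σ) :
    -- a subsequence `κ` of the economies: the expected demands converge to `D` uniformly in the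
    -- deviator and in the cutoffs, and the random cutoffs converge to the cutoffs `pbar` of `D`
    (∃ κ : ℕ → ℕ, StrictMono κ ∧
      ∃ (D : (Fin C → ℝ) → Fin C → ℝ) (pbar : Fin C → ℝ),
        pbar ∈ Set.Icc 0 1 ∧ IsLimitCutoff D S pbar ∧
        ∀ (Ω : Type u) [MeasurableSpace Ω] (μ : Measure Ω) [IsProbabilityMeasure μ]
          (T : (k : ℕ) → Fin k → Ω → ApplicantType C a b) (R : (k : ℕ) → Fin k → Ω → ROL C),
          IsRealization μ η σ T R →
            TendstoUniformly
              (fun (l : ℕ) (x : Option ℕ × Set.Icc (0 : Fin C → ℝ) 1) =>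
                expectedDemand μ T R (κ l) x.1 x.2)
              (fun x => D x.2) atTop ∧
            ∀ᵐ ω ∂μ, Tendsto
              (fun l : ℕ => ⨆ i : Option ℕ, ‖randomCutoff S T R (κ l) i ω - pbar‖)
              atTop (𝓝 0)) ∧
    -- for a symmetric profile, the whole sequence
    (IsSymmetricProfile σ →
      ∃ (D : (Fin C → ℝ) → Fin C → ℝ) (pbar : Fin C → ℝ),
        pbar ∈ Set.Icc 0 1 ∧ IsLimitCutoff D S pbar ∧
        ∀ (Ω : Type u) [MeasurableSpace Ω] (μ : Measure Ω) [IsProbabilityMeasure μ]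
          (T : (k : ℕ) → Fin k → Ω → ApplicantType C a b) (R : (k : ℕ) → Fin k → Ω → ROL C),
          IsRealization μ η σ T R →
            TendstoUniformly
              (fun (k : ℕ) (x : Option ℕ × Set.Icc (0 : Fin C → ℝ) 1) =>
                expectedDemand μ T R k x.1 x.2)
              (fun x => D x.2) atTop ∧
            ∀ᵐ ω ∂μ, Tendsto
              (fun k : ℕ => ⨆ i : Option ℕ, ‖randomCutoff S T R k i ω - pbar‖)
              atTop (𝓝 0)) := by
  have hS0 : ∀ c, 0 < S c := fun c => (hS c).1
  -- Both claims follow once the mean demands converge uniformly along some `κ` tending to infinity.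
  have key : ∀ κ : ℕ → ℕ, Tendsto κ atTop atTop → ∀ D : (Fin C → ℝ) → Fin C → ℝ,
      TendstoUniformlyOn (fun l => meanDemand η σ (κ l)) D atTop (Set.Icc 0 1) →
      ∃ pbar : Fin C → ℝ, pbar ∈ Set.Icc 0 1 ∧ IsLimitCutoff D S pbar ∧
        ∀ (Ω : Type u) [MeasurableSpace Ω] (μ : Measure Ω) [IsProbabilityMeasure μ]
          (T : (k : ℕ) → Fin k → Ω → ApplicantType C a b) (R : (k : ℕ) → Fin k → Ω → ROL C),
          IsRealization μ η σ T R →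
            TendstoUniformly
              (fun (l : ℕ) (x : Option ℕ × Set.Icc (0 : Fin C → ℝ) 1) =>
                expectedDemand μ T R (κ l) x.1 x.2)
              (fun x => D x.2) atTop ∧
            ∀ᵐ ω ∂μ, Tendsto
              (fun l : ℕ => ⨆ i : Option ℕ, ‖randomCutoff S T R (κ l) i ω - pbar‖)
              atTop (𝓝 0) := by
    intro κ hκ D hD
    have hdem := isDemandSystem_of_tendstoUniformlyOn hab hb hη hfull hσ hκ hD
    obtain ⟨p, hp, hlim, hmc⟩ := hdem.exists_isLimitCutoff hS0
    exact ⟨p, hp, hlim, fun Ω _ μ _ T R h => ⟨tendstoUniformly_expectedDemand h hκ hD,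
      ae_tendsto_randomCutoff hη h hS0 hκ hdem hD hp hmc⟩⟩
  constructor
  · obtain ⟨κ, hκ, D, hD⟩ := exists_subseq_tendstoUniformlyOn_meanDemand (σ := σ) hη
    exact ⟨κ, hκ, D, key κ hκ.tendsto_atTop D hD⟩
  · intro hsym
    -- Under symmetry the mean demand is an average of equal terms, so for every `k > 0` it is that
    -- of a single applicant.
    refine ⟨meanDemand η σ 1, key id tendsto_id _ ?_⟩
    refine Metric.tendstoUniformlyOn_iff.2 fun ε hε => ?_
    filter_upwards [eventually_gt_atTop 0] with k hk p _
    have hk' : (k : ℝ) ≠ 0 := by exact_mod_cast hk.ne'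
    have heq : meanDemand η σ (id k) p = meanDemand η σ 1 p := by
      funext c
      simp only [meanDemand, hsym _ 0, id_eq, Finset.sum_const, Finset.card_univ,
        Fintype.card_fin, nsmul_eq_mul]
      field_simp
    rwa [heq, dist_self]
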